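/- Let $R$ be a ring. For a topological space $X$ let $C^n(X;R)$ be the $R$-module of all functions $\phi\colon X^{n+1}\to R$, with coboundary $(d\phi)(x_0,\dots,x_{n+1})=\sum_{i=0}^{n+1}(-1)^i\phi(x_0,\dots,\widehat{x_i},\dots,x_{n+1})$. Let $\|\phi\|$ be the intersection of the diagonal of $X^{n+1}$ with the closure of the support of $\phi$. Let $C_0^*(X;R)$ be the complex of cochains with $\|\phi\|=\emptyset$; for a metric space $X$ let $C_c^*(X;R)$ and $C_b^*(X;R)$ be the complexes of cochains with $\|\phi\|$ compact and bounded, respectively. The boundedly supported cohomology $H_b^*(X;R)$ is the cohomology of $C_b^*(X;R)$, and the compactly supported Alexander–Spanier cohomology $H_c^*(X;R)$ is the cohomology of $C_c^*(X;R)/C_0^*(X;R)$. The coarse cohomology $HX^*(X;R)$ is the cohomology of the complex $CX^*(X;R)\subseteq C_b^*(X;R)$ of cochains whose support meets every $r$-neighbourhood of the diagonal (sup metric on $X^{n+1}$) in a bounded set. A subset $B\subseteq X$ is *contractible inside* $D\supseteq B$ if the inclusion $B\hookrightarrow D$ is nullhomotopic. $X$ is *uniformly contractible* if there is a function $\rho\colon[0,\infty)\to[0,\infty)$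 such that every nonempty set of diameter $r<\infty$ is contractible inside a set of diameter at most $\rho(r)$. $X$ is *uniformly contractible at infinity* if there are nondecreasing functions $\rho,\mu\colon[0,\infty)\to[0,\infty)$ and a point $b\in X$ such that every nonempty set $B$ of diameter $r<\infty$ with $d(b,B)\ge\mu(r)$ is contractible inside a set of diameter at most $\rho(r)$. 1. If $X$ is a proper contractible metric space, then for every $k\ge 0$ there is an isomorphism of $R$-modules $e\colon H_b^k(X;R)\cong H_c^k(X;R)$ which is compatible with the canonical maps from $H^k(C_c^*(X;R))$: if $\iota\colon H^k(C_c^*)\to H_b^k$ is induced by the inclusion $C_c^*\subseteq C_b^*$ and $\pi\colon H^k(C_c^*)\to H_c^k$ by the projection $C_c^*\to C_c^*/C_0^*$, then $e\circ\iota=\pi$. 2. Consequently the theorem "if $X$ is uniformly contractible at infinity, then the inclusion $CX^*\subseteq C_b^*$ induces an isomorphism on cohomology" generalizes Roe's theorem "if $X$ is uniformly contractible, then $HX^*\cong H_c^*$", in the following sense: if a proper contractible metric space $X$ is uniformly contractible, then $X$ is uniformly contractible at infinity, and for every $k$ for which the inclusion induces an isomorphism $HX^k(X;R)\to H_b^k(X;R)$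 one has $HX^k(X;R)\cong H_c^k(X;R)$. 3. For all $n,k\ge 0$, $H_b^k(\mathbb{R}^n;\mathbb{Z})\cong H_c^k(\mathbb{R}^n;\mathbb{Z})\cong\mathbb{Z}$ if $k=n$, and both groups are $0$ if $k\ne n$. -/

import Mathlib

open CategoryTheory
open scoped NNReal

universe u v

namespace CoarseCohomology

section Cochains

variable (R : Type v) [Ring R] (X : Type u)

/-- The `R`-module `Cⁿ(X; R)` of all functions `X^{n+1} → R`. -/
abbrev Cochain (n : ℕ) : Type (max u v) := (Fin (n + 1) → X) → R

/-- The coboundary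
`(dφ)(x₀, …, xₙ₊₁) = ∑ᵢ (-1)ⁱ φ(x₀, …, xᵢ omitted, …, xₙ₊₁)`. -/
def d (n : ℕ) : Cochain R X n →ₗ[R] Cochain R X (n + 1) where
  toFun φ := fun x => ∑ i : Fin (n + 2), (-1 : ℤ) ^ (i : ℕ) • φ (i.removeNth x)
  map_add' φ ψ := by
    funext x
    simp [Finset.sum_add_distrib]
  map_smul' r φ := by
    funext x
    simp only [Pi.smul_apply, RingHom.id_apply, Finset.smul_sum]
    exact Finset.sum_congr rfl fun i _ => smul_comm _ _ _

variable {R X}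

lemma d_apply {n : ℕ} (φ : Cochain R X n) (x : Fin (n + 2) → X) :
    d R X n φ x = ∑ i : Fin (n + 2), (-1 : ℤ) ^ (i : ℕ) • φ (i.removeNth x) := rfl

lemma d_d {n : ℕ} (φ : Cochain R X n) : d R X (n + 1) (d R X n φ) = 0 := by
  funext x
  simp only [d_apply, Finset.smul_sum, Pi.zero_apply]
  rw [← Finset.sum_product']
  refine Finset.sum_involution
    (fun p _ => (p.1.succAbove p.2, p.2.predAbove p.1)) ?_ ?_ ?_ ?_
  · rintro ⟨i, j⟩ -
    have h : (j.predAbove i).removeNth ((i.succAbove j).removeNth x)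
        = j.removeNth (i.removeNth x) := by
      funext k
      simp only [Fin.removeNth]
      rw [Fin.succAbove_succAbove_succAbove_predAbove]
    have hs := Fin.neg_one_pow_succAbove_add_predAbove (R := ℤ) i j
    simp only [h, smul_smul, ← pow_add, hs]
    rw [← add_smul]
    simp
  · rintro ⟨i, j⟩ - - heq
    exact Fin.succAbove_ne i j (congrArg Prod.fst heq)
  · intros; simp
  · rintro ⟨i, j⟩ -
    simp [Fin.succAbove_succAbove_predAbove, Fin.predAbove_predAbove_succAbove]

/-- If `dφ` does not vanish at `x` then `φ` does not vanish at some face of `x`. -/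
lemma exists_face {n : ℕ} {φ : Cochain R X n} {x : Fin (n + 2) → X}
    (hx : d R X n φ x ≠ 0) : ∃ i : Fin (n + 2), φ (i.removeNth x) ≠ 0 := by
  by_contra! h
  exact hx (by simp [d_apply, h])

variable (R X)

/-- A family of submodules of the `Cⁿ(X; R)` which is stable under the coboundary. -/
structure Subcomplex where
  carrier : ∀ n, Submodule R (Cochain R X n)
  d_mem : ∀ n, ∀ φ ∈ carrier n, d R X n φ ∈ carrier (n + 1)

variable {R X}

namespace Subcomplex

instance : LE (Subcomplex R X) := ⟨fun A B => ∀ n, A.carrier n ≤ B.carrier n⟩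

/-- The coboundary restricted to a subcomplex. -/
def dRestrict (A : Subcomplex R X) (n : ℕ) : A.carrier n →ₗ[R] A.carrier (n + 1) :=
  (d R X n).restrict (A.d_mem n)

/-- A subcomplex as a cochain complex of `R`-modules. -/
noncomputable def complex (A : Subcomplex R X) :
    CochainComplex (ModuleCat.{max u v} R) ℕ :=
  CochainComplex.of (fun n => ModuleCat.of R (A.carrier n))
    (fun n => ModuleCat.ofHom (A.dRestrict n))
    (fun n => by
      ext : 1
      refine LinearMap.ext fun φ => ?_
      exact Subtype.ext (d_d φ.1))

lemma complex_d (A : Subcomplex R X) (n : ℕ) :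
    A.complex.d n (n + 1) = ModuleCat.ofHom (A.dRestrict n) :=
  CochainComplex.of_d _ (fun n => ModuleCat.ofHom (A.dRestrict n)) n

/-- The coboundary induced on the quotients `Bⁿ / Aⁿ`. -/
def dQuotient {A B : Subcomplex R X} (_h : A ≤ B) (n : ℕ) :
    (B.carrier n ⧸ (A.carrier n).submoduleOf (B.carrier n)) →ₗ[R]
      (B.carrier (n + 1) ⧸ (A.carrier (n + 1)).submoduleOf (B.carrier (n + 1))) :=
  Submodule.mapQ _ _ (B.dRestrict n) (fun φ hφ => A.d_mem n φ.1 hφ)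

/-- The quotient complex `B / A` of a subcomplex `B` by a smaller subcomplex `A`. -/
noncomputable def quotient {A B : Subcomplex R X} (h : A ≤ B) :
    CochainComplex (ModuleCat.{max u v} R) ℕ :=
  CochainComplex.of
    (fun n => ModuleCat.of R (B.carrier n ⧸ (A.carrier n).submoduleOf (B.carrier n)))
    (fun n => ModuleCat.ofHom (dQuotient h n))
    (fun n => by
      ext : 1
      refine LinearMap.ext fun φ => ?_
      obtain ⟨φ, rfl⟩ := Submodule.Quotient.mk_surjective _ φ
      change Submodule.Quotient.mk (B.dRestrict (n + 1) (B.dRestrict n φ)) = 0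
      rw [show B.dRestrict (n + 1) (B.dRestrict n φ) = 0 from Subtype.ext (d_d φ.1)]
      rfl)

lemma quotient_d {A B : Subcomplex R X} (h : A ≤ B) (n : ℕ) :
    (quotient h).d n (n + 1) = ModuleCat.ofHom (dQuotient h n) :=
  CochainComplex.of_d
    (fun n => ModuleCat.of R (B.carrier n ⧸ (A.carrier n).submoduleOf (B.carrier n)))
    (fun n => ModuleCat.ofHom (dQuotient h n)) n

/-- The inclusion of a subcomplex into a larger one. -/
noncomputable def inclusion {A B : Subcomplex R X} (h : A ≤ B) : A.complex ⟶ B.complex :=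
  CochainComplex.ofHom (X := A.complex) (Y := B.complex)
    (fun n => ModuleCat.ofHom (Submodule.inclusion (h n)))
    (fun n => by
      rw [complex_d, complex_d]
      rfl)

/-- The projection of a subcomplex onto its quotient by a smaller one. -/
noncomputable def projection {A B : Subcomplex R X} (h : A ≤ B) : B.complex ⟶ quotient h :=
  CochainComplex.ofHom (X := B.complex) (Y := quotient h)
    (fun n => ModuleCat.ofHom ((A.carrier n).submoduleOf (B.carrier n)).mkQ)
    (fun n => by
      rw [complex_d, quotient_d]
      rfl)

end Subcomplex

end Cochains

section DiagonalSupport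

variable {R : Type v} [Ring R] {X : Type u}

/-- The set `‖φ‖`: the intersection of the diagonal of `X^{n+1}` with the closure of the
support of `φ`. -/
def diagSupport [TopologicalSpace X] {n : ℕ} (φ : Cochain R X n) : Set (Fin (n + 1) → X) :=
  Set.range (fun (x : X) (_ : Fin (n + 1)) => x) ∩ closure (Function.support φ)

section Topological

variable [TopologicalSpace X]

lemma const_mem_diagSupport {n : ℕ} {φ : Cochain R X n} {x : X} :
    (fun _ => x) ∈ diagSupport φ ↔ (fun _ => x) ∈ closure (Function.support φ) :=
  ⟨fun h => h.2, fun h => ⟨⟨x, rfl⟩, h⟩⟩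

lemma diagSupport_zero {n : ℕ} : diagSupport (0 : Cochain R X n) = ∅ := by
  simp [diagSupport]

lemma diagSupport_add {n : ℕ} (φ ψ : Cochain R X n) :
    diagSupport (φ + ψ) ⊆ diagSupport φ ∪ diagSupport ψ := by
  rintro x ⟨hx, h⟩
  have := closure_mono (Function.support_add φ ψ) h
  rw [closure_union] at this
  exact this.imp (fun h => ⟨hx, h⟩) (fun h => ⟨hx, h⟩)

lemma diagSupport_smul {n : ℕ} (r : R) (φ : Cochain R X n) :
    diagSupport (r • φ) ⊆ diagSupport φ := by
  rintro x ⟨hx, h⟩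
  refine ⟨hx, closure_mono ?_ h⟩
  intro y hy h0
  exact hy (by simp [h0])

lemma isClosed_diagSupport [T2Space X] {n : ℕ} (φ : Cochain R X n) :
    IsClosed (diagSupport φ) := by
  refine IsClosed.inter ?_ isClosed_closure
  have : Set.range (fun (x : X) (_ : Fin (n + 1)) => x)
      = ⋂ i : Fin (n + 1), {y | y i = y 0} := by
    ext y
    rw [Set.mem_range, Set.mem_iInter]
    constructor
    · rintro ⟨x, rfl⟩ i; rfl
    · intro h; exact ⟨y 0, funext fun i => (h i).symm⟩
  rw [this]
  exact isClosed_iInter fun i => isClosed_eq (continuous_apply i) (continuous_apply 0)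

lemma diagSupport_d {n : ℕ} (φ : Cochain R X n) :
    diagSupport (d R X n φ) ⊆
      (fun (y : Fin (n + 1) → X) (_ : Fin (n + 2)) => y 0) '' diagSupport φ := by
  rintro _ ⟨⟨x, rfl⟩, h⟩
  refine ⟨fun _ => x, ⟨⟨x, rfl⟩, ?_⟩, rfl⟩
  have hsub : Function.support (d R X n φ) ⊆
      ⋃ i : Fin (n + 2), (fun y : Fin (n + 2) → X => i.removeNth y) ⁻¹' Function.support φ := by
    intro y hy
    obtain ⟨i, hi⟩ := exists_face hy
    exact Set.mem_iUnion.2 ⟨i, hi⟩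
  have h1 := closure_mono hsub h
  rw [closure_iUnion_of_finite, Set.mem_iUnion] at h1
  obtain ⟨i, hi⟩ := h1
  have hc : Continuous (fun y : Fin (n + 2) → X => i.removeNth y) :=
    continuous_pi fun k => continuous_apply _
  exact hc.closure_preimage_subset _ hi

variable (R X)

/-- The complex `C₀(X; R)` of locally zero cochains. -/
def locallyZero : Subcomplex R X where
  carrier n :=
    { carrier := {φ | diagSupport φ = ∅}
      zero_mem' := diagSupport_zero
      add_mem' := fun {φ ψ} hφ hψ => Set.subset_empty_iff.1
        ((diagSupport_add φ ψ).trans (by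
          rw [show diagSupport φ = ∅ from hφ, show diagSupport ψ = ∅ from hψ,
            Set.union_empty]))
      smul_mem' := fun r φ hφ => Set.subset_empty_iff.1
        ((diagSupport_smul r φ).trans (Set.subset_empty_iff.2 hφ)) }
  d_mem n φ hφ := Set.subset_empty_iff.1 ((diagSupport_d φ).trans (by
    rw [show diagSupport φ = ∅ from hφ, Set.image_empty]))

/-- The complex `C_c(X; R)` of cochains `φ` with `‖φ‖` compact. -/
def compactlySupported [T2Space X] : Subcomplex R X where
  carrier n :=
    { carrier := {φ | IsCompact (diagSupport φ)}
      zero_mem' := by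
        change IsCompact (diagSupport (0 : Cochain R X n))
        rw [diagSupport_zero]
        exact isCompact_empty
      add_mem' := fun {φ ψ} hφ hψ =>
        (IsCompact.union hφ hψ).of_isClosed_subset (isClosed_diagSupport _)
          (diagSupport_add φ ψ)
      smul_mem' := fun r φ hφ =>
        IsCompact.of_isClosed_subset hφ (isClosed_diagSupport _) (diagSupport_smul r φ) }
  d_mem n φ hφ :=
    (IsCompact.image hφ (continuous_pi fun _ => continuous_apply 0)).of_isClosed_subset
      (isClosed_diagSupport _) (diagSupport_d φ)

lemma locallyZero_le_compactlySupported [T2Space X] :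
    locallyZero R X ≤ compactlySupported R X := fun n φ hφ => by
  change IsCompact (diagSupport φ)
  rw [show diagSupport φ = ∅ from hφ]
  exact isCompact_empty

/-- The compactly supported Alexander-Spanier complex `C_c(X; R) / C₀(X; R)`. -/
noncomputable def compactASComplex [T2Space X] : CochainComplex (ModuleCat.{max u v} R) ℕ :=
  Subcomplex.quotient (locallyZero_le_compactlySupported R X)

/-- Compactly supported Alexander-Spanier cohomology `H_cᵏ(X; R)`. -/
noncomputable def Hc [T2Space X] (k : ℕ) : ModuleCat.{max u v} R :=
  (compactASComplex R X).homology k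

end Topological

section Metric

variable [MetricSpace X]

variable (R X)

/-- The complex `C_b(X; R)` of boundedly supported cochains: those `φ` with `‖φ‖` bounded. -/
def boundedlySupported : Subcomplex R X where
  carrier n :=
    { carrier := {φ | Bornology.IsBounded (diagSupport φ)}
      zero_mem' := by
        change Bornology.IsBounded (diagSupport (0 : Cochain R X n))
        rw [diagSupport_zero]
        exact Bornology.isBounded_empty
      add_mem' := fun {φ ψ} hφ hψ =>
        (Bornology.IsBounded.union (s := diagSupport φ) (t := diagSupport ψ) hφ hψ).subset
          (diagSupport_add φ ψ)
      smul_mem' := fun r φ hφ =>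
        Bornology.IsBounded.subset (t := diagSupport φ) hφ (diagSupport_smul r φ) }
  d_mem n φ hφ := by
    refine Bornology.IsBounded.subset ?_ (diagSupport_d φ)
    refine LipschitzWith.isBounded_image (K := 1) (LipschitzWith.of_dist_le_mul ?_) hφ
    intro y z
    simp only [NNReal.coe_one, one_mul]
    exact (dist_pi_le_iff dist_nonneg).2 fun _ => dist_le_pi_dist y z 0

lemma compactlySupported_le_boundedlySupported :
    compactlySupported R X ≤ boundedlySupported R X :=
  fun _ _ hφ => IsCompact.isBounded hφ

/-- Boundedly supported cohomology `H_bᵏ(X; R)`. -/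
noncomputable def Hb (k : ℕ) : ModuleCat.{max u v} R :=
  (boundedlySupported R X).complex.homology k

/-- The coarse complex: cochains whose support meets every neighbourhood `N_r(Δ)` of the
diagonal `Δ` of `X^{n+1}` (with the sup metric) in a bounded set. -/
def coarse : Subcomplex R X where
  carrier n :=
    { carrier := {φ | ∀ r : ℝ, Bornology.IsBounded (Function.support φ ∩
        Metric.thickening r (Set.range (fun (x : X) (_ : Fin (n + 1)) => x)))}
      zero_mem' := fun r => by simp
      add_mem' := fun {φ ψ} hφ hψ r => by
        refine ((hφ r).union (hψ r)).subset ?_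
        rintro x ⟨hx, hr⟩
        exact (Function.support_add φ ψ hx).imp (fun h => ⟨h, hr⟩) (fun h => ⟨h, hr⟩)
      smul_mem' := fun a φ hφ r => by
        refine (hφ r).subset ?_
        rintro x ⟨hx, hr⟩
        exact ⟨fun h0 => hx (by simp [h0]), hr⟩ }
  d_mem n φ hφ := fun r => by
    rcases isEmpty_or_nonempty X with hX | ⟨⟨b⟩⟩
    · exact Metric.isBounded_of_compactSpace
    obtain ⟨C, hC⟩ := (hφ r).subset_closedBall (fun _ => b)
    refine (Metric.isBounded_closedBall (x := fun _ => b) (r := C + r + r)).subset ?_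
    rintro x ⟨hx, hr⟩
    obtain ⟨i, hi⟩ := exists_face hx
    obtain ⟨_, ⟨z, rfl⟩, hz⟩ := Metric.mem_thickening_iff.1 hr
    have hzk : ∀ k, dist (x k) z < r := fun k =>
      lt_of_le_of_lt (dist_le_pi_dist x (fun _ => z) k) hz
    have hrpos : 0 < r := dist_nonneg.trans_lt hz
    have hface : i.removeNth x ∈ Function.support φ ∩
        Metric.thickening r (Set.range (fun (x : X) (_ : Fin (n + 1)) => x)) := by
      refine ⟨hi, Metric.mem_thickening_iff.2 ⟨_, ⟨z, rfl⟩, ?_⟩⟩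
      exact (dist_pi_lt_iff hrpos).2 fun k => hzk _
    have h0 : dist (x (i.succAbove 0)) b ≤ C :=
      (dist_le_pi_dist (i.removeNth x) (fun _ => b) 0).trans (Metric.mem_closedBall.1 (hC hface))
    have hC0 : 0 ≤ C := dist_nonneg.trans h0
    rw [Metric.mem_closedBall]
    refine (dist_pi_le_iff (by positivity)).2 fun k => ?_
    have h1 := dist_triangle4 (x k) z (x (i.succAbove 0)) b
    have h2 := hzk k
    have h3 := hzk (i.succAbove 0)
    rw [dist_comm] at h3
    linarith

lemma coarse_le_boundedlySupported : coarse R X ≤ boundedlySupported R X := by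
  intro n φ hφ
  refine (hφ 1).closure.subset ?_
  rintro x ⟨hx, h⟩
  have hmem : x ∈ Metric.thickening 1 (Set.range (fun (x : X) (_ : Fin (n + 1)) => x)) :=
    Metric.self_subset_thickening one_pos _ hx
  rw [Set.inter_comm]
  exact Metric.isOpen_thickening.inter_closure ⟨hmem, h⟩

/-- Coarse cohomology `HXᵏ(X; R)`. -/
noncomputable def HX (k : ℕ) : ModuleCat.{max u v} R :=
  (coarse R X).complex.homology k

/-- The map `Hᵏ(C_c(X; R)) → H_bᵏ(X; R)` induced by the inclusion `C_c ⊆ C_b`. -/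
noncomputable def compactToHb (k : ℕ) :
    (compactlySupported R X).complex.homology k ⟶ Hb R X k :=
  HomologicalComplex.homologyMap
    (Subcomplex.inclusion (compactlySupported_le_boundedlySupported R X)) k

/-- The map `Hᵏ(C_c(X; R)) → H_cᵏ(X; R)` induced by the projection `C_c → C_c / C₀`. -/
noncomputable def compactToHc (k : ℕ) :
    (compactlySupported R X).complex.homology k ⟶ Hc R X k :=
  HomologicalComplex.homologyMap
    (Subcomplex.projection (locallyZero_le_compactlySupported R X)) k

/-- The map `HXᵏ(X; R) → H_bᵏ(X; R)` induced by the inclusion of coarse cochains into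
boundedly supported ones. -/
noncomputable def coarseToHb (k : ℕ) : HX R X k ⟶ Hb R X k :=
  HomologicalComplex.homologyMap
    (Subcomplex.inclusion (coarse_le_boundedlySupported R X)) k

end Metric

end DiagonalSupport

section UniformContractibility

variable {X : Type u}

/-- `B` is contractible inside `D`: `B ⊆ D` and the inclusion map is nullhomotopic. -/
def ContractibleInside [TopologicalSpace X] (B D : Set X) : Prop :=
  ∃ h : B ⊆ D, (⟨Set.inclusion h, continuous_inclusion h⟩ : C(B, D)).Nullhomotopic

variable (X) [MetricSpace X]

/-- There is a function `ρ` such that every (nonempty) set of diameter `r` is contractible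
inside a set of diameter at most `ρ r`. -/
def UniformlyContractible : Prop :=
  ∃ ρ : ℝ≥0 → ℝ≥0, ∀ (r : ℝ≥0) (B : Set X), B.Nonempty → Bornology.IsBounded B →
    Metric.diam B = r →
      ∃ D : Set X, Bornology.IsBounded D ∧ Metric.diam D ≤ ρ r ∧ ContractibleInside B D

/-- There are nondecreasing functions `ρ`, `μ` and a basepoint `b` such that every (nonempty)
set `B` of diameter `r` with `d(b, B) ≥ μ r` is contractible inside a set of diameter at most
`ρ r`. -/
def UniformlyContractibleAtInfinity : Prop :=
  ∃ ρ μ : ℝ≥0 → ℝ≥0, Monotone ρ ∧ Monotone μ ∧ ∃ b : X,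
    ∀ (r : ℝ≥0) (B : Set X), B.Nonempty → Bornology.IsBounded B → Metric.diam B = r →
      (μ r : ℝ) ≤ Metric.infDist b B →
        ∃ D : Set X, Bornology.IsBounded D ∧ Metric.diam D ≤ ρ r ∧ ContractibleInside B D

end UniformContractibility

end CoarseCohomology

/-! In a proper space closed bounded sets are compact, so `C_b = C_c` and `compactToHb` is an
isomorphism. If `C₀` is acyclic, the long exact sequence of `C₀ → C_c → C_c / C₀` makes
`compactToHc` an isomorphism too, and `e` is the composite.

Acyclicity of `C₀` is homotopy invariance with control of supports (`exists_homotopy_cochain`):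
along a contraction of `X`, a locally zero cocycle of positive degree differs by the coboundary of a
locally zero cochain from its pullback under a constant map, which is zero. The difficulty is that
the required subdivision of the homotopy tracks depends on the point of `X`. Acyclic carriers
resolve this: every simplex uses its own contraction of the cylinder, of dyadic fineness the minimum
of the levels of its vertices. A face then has at least as fine a carrier, so the recursive homotopy
still vanishes where it should.

For `ℝⁿ`, support conditions are encoded by filters. With no condition (`⊥`) the cohomology is `R`
in degree 0. Boundedness in one more coordinate is the conjunction of a condition at `-∞` and one at
`+∞`. Each alone gives an acyclic complex, since everything can be pushed to that end, and the two
complexes span the previous one. Mayer-Vietoris therefore raises the degree by one per coordinate,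
and after `n` steps the complex is `C_b`.

In the second part only the monotonicity of `ρ` needs work: in an unbounded connected space, sets
can be enlarged to a prescribed diameter, which allows `ρ` to be replaced by an infimum over larger
arguments. -/

namespace CoarseCohomology

/-! ### Cochain homotopies from acyclic carriers -/

section Homotopies

variable {R : Type v} [Ring R] {A Y : Type*}

/-- The pullback of cochains along a map. -/
def pullback (f : A → Y) (n : ℕ) : Cochain R Y n →ₗ[R] Cochain R A n where
  toFun ω σ := ω (f ∘ σ)
  map_add' _ _ := rfl
  map_smul' _ _ := rfl

@[simp] lemma pullback_apply (f : A → Y) {n : ℕ} (ω : Cochain R Y n) (σ : Fin (n + 1) → A) :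
    pullback f n ω σ = ω (f ∘ σ) := rfl

lemma d_pullback (f : A → Y) {n : ℕ} (ω : Cochain R Y n) :
    d R A n (pullback f n ω) = pullback f (n + 1) (d R Y n ω) := rfl

/-- The cone operator with apex `p`. -/
def cone (p : Y) (n : ℕ) : Cochain R Y (n + 1) →ₗ[R] Cochain R Y n where
  toFun ω v := ω (Fin.cons p v)
  map_add' _ _ := rfl
  map_smul' _ _ := rfl

@[simp] lemma cone_apply (p : Y) {n : ℕ} (ω : Cochain R Y (n + 1)) (v : Fin (n + 1) → Y) :
    cone p n ω v = ω (Fin.cons p v) := rfl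

lemma cone_d_zero (p : Y) (ω : Cochain R Y 0) (v : Fin 1 → Y) :
    cone p 0 (d R Y 0 ω) v = ω v - ω (fun _ => p) := by
  have h1 : (0 : Fin 2).removeNth (Fin.cons p v : Fin 2 → Y) = v := by
    funext i; fin_cases i; rfl
  have h2 : (1 : Fin 2).removeNth (Fin.cons p v : Fin 2 → Y) = fun _ => p := by
    funext i; fin_cases i; rfl
  simp [d_apply, Fin.sum_univ_two, h1, h2, sub_eq_add_neg]

lemma cone_d_succ (p : Y) {n : ℕ} (ω : Cochain R Y (n + 1)) :
    cone p (n + 1) (d R Y (n + 1) ω) = ω - d R Y n (cone p n ω) := by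
  funext v
  have h1 : (0 : Fin (n + 3)).removeNth (Fin.cons p v : Fin (n + 3) → Y) = v := by
    funext i; simp [Fin.removeNth]
  have h2 : ∀ i : Fin (n + 2), (i.succ).removeNth (Fin.cons p v : Fin (n + 3) → Y)
      = Fin.cons p (i.removeNth v) := by
    intro i
    funext k
    refine Fin.cases ?_ (fun k => ?_) k
    · simp [Fin.removeNth]
    · simp [Fin.removeNth]
  rw [cone_apply, d_apply, Fin.sum_univ_succ, h1]
  simp only [h2, Pi.sub_apply, d_apply, cone_apply, Fin.val_succ, pow_succ, Fin.val_zero, pow_zero,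
    one_smul, mul_neg, mul_one, neg_smul, Finset.sum_neg_distrib, sub_eq_add_neg]

variable (R Y) in
/-- A contraction of the complex of all cochains on `Y` onto its value at a base point. -/
structure Contraction where
  op : ∀ n, Cochain R Y (n + 1) →ₗ[R] Cochain R Y n
  base : Y
  op_d_zero : ∀ (ω : Cochain R Y 0) (v : Fin 1 → Y),
    op 0 (d R Y 0 ω) v = ω v - ω (fun _ => base)
  op_d_succ : ∀ (n : ℕ) (ω : Cochain R Y (n + 1)),
    op (n + 1) (d R Y (n + 1) ω) = ω - d R Y n (op n ω)

/-- The contraction given by coning off. -/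
def coneContraction (p : Y) : Contraction R Y where
  op := cone p
  base := p
  op_d_zero := cone_d_zero p
  op_d_succ _ := cone_d_succ p

/-- The homotopy between the pullbacks along `f` and `g` built by recursion on the degree
from a contraction for every simplex. -/
def carrierHomotopy (F : ∀ n, (Fin (n + 1) → A) → Contraction R Y) (f g : A → Y) :
    ∀ n, Cochain R Y (n + 1) →ₗ[R] Cochain R A n
  | 0 => LinearMap.pi fun σ =>
      LinearMap.proj σ ∘ₗ (pullback g 0 - pullback f 0) ∘ₗ (F 0 σ).op 0
  | n + 1 => LinearMap.pi fun σ =>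
      LinearMap.proj σ ∘ₗ
        (pullback g (n + 1) - pullback f (n + 1) - d R A n ∘ₗ carrierHomotopy F f g n) ∘ₗ
          (F (n + 1) σ).op (n + 1)

variable (F : ∀ n, (Fin (n + 1) → A) → Contraction R Y) (f g : A → Y)

lemma carrierHomotopy_zero_apply (ω : Cochain R Y 1) (σ : Fin 1 → A) :
    carrierHomotopy F f g 0 ω σ
      = (F 0 σ).op 0 ω (g ∘ σ) - (F 0 σ).op 0 ω (f ∘ σ) := rfl

lemma carrierHomotopy_succ_apply (n : ℕ) (ω : Cochain R Y (n + 2)) (σ : Fin (n + 2) → A) :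
    carrierHomotopy F f g (n + 1) ω σ
      = (F (n + 1) σ).op (n + 1) ω (g ∘ σ) - (F (n + 1) σ).op (n + 1) ω (f ∘ σ)
        - d R A n (carrierHomotopy F f g n ((F (n + 1) σ).op (n + 1) ω)) σ := rfl

lemma carrierHomotopy_d_zero (ω : Cochain R Y 0) :
    carrierHomotopy F f g 0 (d R Y 0 ω) = pullback g 0 ω - pullback f 0 ω := by
  funext σ
  simp [carrierHomotopy_zero_apply, (F 0 σ).op_d_zero]

/-- Dual of the acyclic carrier construction on chains: `op_d_succ` turns `op (dω)` into `ω - d (op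
ω)`, and the error terms cancel by the same identity one degree lower. -/
lemma carrierHomotopy_d_succ (n : ℕ) (ω : Cochain R Y (n + 1)) :
    carrierHomotopy F f g (n + 1) (d R Y (n + 1) ω) + d R A n (carrierHomotopy F f g n ω)
      = pullback g (n + 1) ω - pullback f (n + 1) ω := by
  induction n with
  | zero =>
    funext σ
    have h := carrierHomotopy_d_zero F f g ((F 1 σ).op 0 ω)
    simp only [Pi.add_apply, carrierHomotopy_succ_apply, (F 1 σ).op_d_succ, map_sub, h,
      d_pullback, Pi.sub_apply, pullback_apply]
    abel
  | succ n ih =>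
    funext σ
    have h := congrArg (fun z => d R A (n + 1) z σ) (ih ((F (n + 2) σ).op (n + 1) ω))
    simp only [map_add, d_d, add_zero, map_sub, d_pullback, Pi.sub_apply, pullback_apply] at h
    simp only [Pi.add_apply, carrierHomotopy_succ_apply, (F (n + 2) σ).op_d_succ, map_sub, h,
      Pi.sub_apply, pullback_apply]
    abel

/-- A cochain vanishes on a set of simplices spanned by the members of `𝒮`. -/
def VanishesOn {n : ℕ} (ω : Cochain R Y n) (𝒮 : Set (Set Y)) : Prop :=
  ∀ S ∈ 𝒮, ∀ v : Fin (n + 1) → Y, (∀ i, v i ∈ S) → ω v = 0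

variable {F f g}

/-- The recursion sees `ω` only through contractions that preserve vanishing on the carriers, and
`hface` passes vanishing from a simplex to its faces, so induction on the degree applies. -/
lemma carrierHomotopy_eq_zero (𝒮 : ∀ n, (Fin (n + 1) → A) → Set (Set Y))
    (hface : ∀ n (σ : Fin (n + 2) → A) (i : Fin (n + 2)), ∀ S ∈ 𝒮 n (i.removeNth σ),
      ∃ T ∈ 𝒮 (n + 1) σ, S ⊆ T)
    (hf : ∀ n σ, ∃ S ∈ 𝒮 n σ, ∀ i, f (σ i) ∈ S) (hg : ∀ n σ, ∃ S ∈ 𝒮 n σ, ∀ i, g (σ i) ∈ S)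
    (hF : ∀ n σ m (ω : Cochain R Y (m + 1)), VanishesOn ω (𝒮 n σ) →
      VanishesOn ((F n σ).op m ω) (𝒮 n σ))
    (n : ℕ) (σ : Fin (n + 1) → A) (ω : Cochain R Y (n + 1)) (hω : VanishesOn ω (𝒮 n σ)) :
    carrierHomotopy F f g n ω σ = 0 := by
  induction n with
  | zero =>
    obtain ⟨S, hS, h1⟩ := hf 0 σ
    obtain ⟨T, hT, h2⟩ := hg 0 σ
    rw [carrierHomotopy_zero_apply, hF _ _ _ _ hω S hS (f ∘ σ) h1, hF _ _ _ _ hω T hT (g ∘ σ) h2, sub_zero]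
  | succ n ih =>
    obtain ⟨S, hS, h1⟩ := hf (n + 1) σ
    obtain ⟨T, hT, h2⟩ := hg (n + 1) σ
    rw [carrierHomotopy_succ_apply, hF _ _ _ _ hω S hS (f ∘ σ) h1, hF _ _ _ _ hω T hT (g ∘ σ) h2, sub_zero,
      zero_sub, neg_eq_zero, d_apply]
    refine Finset.sum_eq_zero fun i _ => ?_
    rw [ih, smul_zero]
    intro S hS v hv
    obtain ⟨T, hT, hST⟩ := hface n σ i S hS
    exact hF _ _ _ _ hω T hT v fun k => hST (hv k)

/-- The prism operator, a homotopy between the pullbacks along `f` and `g`. -/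
def prism (f g : A → Y) : ∀ n, Cochain R Y (n + 1) →ₗ[R] Cochain R A n :=
  carrierHomotopy (fun _ σ => coneContraction (f (σ 0))) f g

lemma prism_eq_zero {n : ℕ} {σ : Fin (n + 1) → A} {ω : Cochain R Y (n + 1)} {S : Set Y}
    (hf : ∀ i, f (σ i) ∈ S) (hg : ∀ i, g (σ i) ∈ S) (hω : VanishesOn ω {S}) :
    prism f g n ω σ = 0 := by
  -- The carrier is the vertex set of the prism over `σ`; it contains the cone apex `f (σ 0)`.
  refine carrierHomotopy_eq_zero (fun n σ => {Set.range (f ∘ σ) ∪ Set.range (g ∘ σ)})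
    ?_ ?_ ?_ ?_ n σ ω ?_
  · rintro n σ i S rfl
    refine ⟨_, rfl, Set.union_subset_union ?_ ?_⟩
    · rintro _ ⟨k, rfl⟩; exact ⟨_, rfl⟩
    · rintro _ ⟨k, rfl⟩; exact ⟨_, rfl⟩
  · exact fun n σ => ⟨_, rfl, fun i => Or.inl ⟨i, rfl⟩⟩
  · exact fun n σ => ⟨_, rfl, fun i => Or.inr ⟨i, rfl⟩⟩
  · rintro n σ m ω hω S rfl v hv
    refine hω _ rfl _ fun i => ?_
    refine Fin.cases ?_ (fun i => ?_) i
    · exact Or.inl ⟨0, rfl⟩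
    · simpa using hv i
  · rintro T rfl v hv
    refine hω S rfl v fun i => ?_
    rcases hv i with ⟨k, hk⟩ | ⟨k, hk⟩
    · rw [← hk]; exact hf k
    · rw [← hk]; exact hg k

lemma prism_d_zero (ω : Cochain R Y 0) :
    prism f g 0 (d R Y 0 ω) = pullback g 0 ω - pullback f 0 ω :=
  carrierHomotopy_d_zero _ f g ω

lemma prism_d_succ (n : ℕ) (ω : Cochain R Y (n + 1)) :
    prism f g (n + 1) (d R Y (n + 1) ω)
      = pullback g (n + 1) ω - pullback f (n + 1) ω - d R A n (prism f g n ω) :=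
  eq_sub_of_add_eq (carrierHomotopy_d_succ _ f g n ω)

end Homotopies

/-! ### Dyadic contractions of the cylinder -/

section Interval

variable {R : Type v} [Ring R] {X : Type u}

/-- The `j`-th dyadic interval of length `2⁻ᴺ`. -/
noncomputable def dyadic (N j : ℕ) : Set ℝ := Set.Icc (j / 2 ^ N) ((j + 1) / 2 ^ N)

lemma dyadic_subset {M N : ℕ} (h : M ≤ N) {j : ℕ} (hj : j < 2 ^ N) :
    ∃ i < 2 ^ M, dyadic N j ⊆ dyadic M i := by
  obtain ⟨k, rfl⟩ := Nat.exists_eq_add_of_le h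
  -- Floor division gives the coarse interval containing the `j`-th fine one.
  refine ⟨j / 2 ^ k, ?_, Set.Icc_subset_Icc ?_ ?_⟩
  · rw [Nat.div_lt_iff_lt_mul (by positivity), ← pow_add]; exact hj
  · rw [div_le_div_iff₀ (by positivity) (by positivity)]
    have : j / 2 ^ k * 2 ^ k ≤ j := Nat.div_mul_le_self _ _
    have h2 : ((j / 2 ^ k : ℕ) : ℝ) * 2 ^ k ≤ j := by exact_mod_cast this
    rw [pow_add]
    nlinarith [show (0 : ℝ) < 2 ^ M by positivity]
  · rw [div_le_div_iff₀ (by positivity) (by positivity)]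
    have : j + 1 ≤ (j / 2 ^ k + 1) * 2 ^ k := by
      have := Nat.lt_div_mul_add (a := j) (b := 2 ^ k) (by positivity)
      rw [add_mul, one_mul]; omega
    have h2 : (j : ℝ) + 1 ≤ (((j / 2 ^ k : ℕ) : ℝ) + 1) * 2 ^ k := by exact_mod_cast this
    rw [pow_add]
    nlinarith [show (0 : ℝ) < 2 ^ M by positivity]

/-- The map pushing the part of `X × ℝ` above height `a` down to height `a`. -/
noncomputable def cutoff (a : ℝ) (y : X × ℝ) : X × ℝ := (y.1, min y.2 a)

/-- The contraction of `X × [0, 1]` that first pushes down one dyadic interval after the other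
and then cones off with apex `(p, 0)`. -/
noncomputable def cylinderContraction (N : ℕ) (p : X) : Contraction R (X × ℝ) where
  -- The prism terms telescope from the identity to the cutoff at height 0, where the cone takes
  -- over.
  op n := prism (cutoff 1) id n
    + ∑ j ∈ Finset.range (2 ^ N), prism (cutoff (j / 2 ^ N)) (cutoff ((j + 1 : ℕ) / 2 ^ N)) n
    + pullback (fun y => (y.1, min y.2 0)) n ∘ₗ cone (p, 0) n
  base := (p, 0)
  op_d_zero ω v := by
    simp only [LinearMap.add_apply, LinearMap.sum_apply, LinearMap.comp_apply, prism_d_zero,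
      Finset.sum_range_sub (fun j : ℕ => pullback (cutoff (X := X) (j / 2 ^ N)) 0 ω),
      Pi.add_apply, Pi.sub_apply, pullback_apply, cone_d_zero]
    simp [cutoff, Function.comp_def]
  op_d_succ n ω := by
    simp only [LinearMap.add_apply, LinearMap.sum_apply, LinearMap.comp_apply, prism_d_succ,
      Finset.sum_sub_distrib,
      Finset.sum_range_sub (fun j : ℕ => pullback (cutoff (X := X) (j / 2 ^ N)) (n + 1) ω),
      cone_d_succ, map_add, map_sum, map_sub, d_pullback]
    funext v
    simp [cutoff, Function.comp_def]
    abel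

/-- The sets `S × J` with `J` a dyadic interval of length `2⁻ᴺ` in `[0, 1]`. -/
def cylinders (S : Set X) (N : ℕ) : Set (Set (X × ℝ)) :=
  {T | ∃ j < 2 ^ N, T = S ×ˢ dyadic N j}

lemma cylinders_mono {S T : Set X} (hST : S ⊆ T) {M N : ℕ} (h : M ≤ N) :
    ∀ U ∈ cylinders S N, ∃ V ∈ cylinders T M, U ⊆ V := by
  rintro _ ⟨j, hj, rfl⟩
  obtain ⟨i, hi, hsub⟩ := dyadic_subset h hj
  exact ⟨_, ⟨i, hi, rfl⟩, Set.prod_mono hST hsub⟩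

lemma VanishesOn.mono {Y : Type*} {n : ℕ} {ω : Cochain R Y n} {𝒮 𝒯 : Set (Set Y)}
    (hω : VanishesOn ω 𝒯) (h : ∀ S ∈ 𝒮, ∃ T ∈ 𝒯, S ⊆ T) : VanishesOn ω 𝒮 := by
  intro S hS v hv
  obtain ⟨T, hT, hST⟩ := h S hS
  exact hω T hT v fun i => hST (hv i)

/-- No prism straddles two slabs `S ×ˢ dyadic N i`. For vertices in slab `j`, both ends of the
`i`-th prism lie in slab `i` if `i ≤ j`, and both equal the given vertices if `i > j`. The final
cone lies at height 0, inside slab 0. -/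
lemma VanishesOn.cylinderContraction_op {S : Set X} {N m : ℕ} {p : X} (hp : p ∈ S)
    {ω : Cochain R (X × ℝ) (m + 1)} (hω : VanishesOn ω (cylinders S N)) :
    VanishesOn ((cylinderContraction N p).op m ω) (cylinders S N) := by
  rintro _ ⟨j, hj, rfl⟩ v hv
  have hpos : (0 : ℝ) < 2 ^ N := by positivity
  have hω' : ∀ i < 2 ^ N, VanishesOn ω {S ×ˢ dyadic N i} := by
    rintro i hi _ rfl
    exact hω _ ⟨i, hi, rfl⟩
  have hle1 : ∀ k, (v k).2 ≤ 1 := by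
    intro k
    refine (hv k).2.2.trans ?_
    rw [div_le_one hpos]
    exact_mod_cast hj
  have h1 : prism (cutoff 1) id m ω v = 0 := by
    refine prism_eq_zero (S := S ×ˢ dyadic N j) (fun k => ?_) hv (hω' j hj)
    have : cutoff 1 (v k) = v k := Prod.ext rfl (min_eq_left (hle1 k))
    rw [this]; exact hv k
  have h2 : ∀ i ∈ Finset.range (2 ^ N),
      prism (cutoff (i / 2 ^ N)) (cutoff ((i + 1 : ℕ) / 2 ^ N)) m ω v = 0 := by
    intro i hi
    rw [Finset.mem_range] at hi
    have hmono : (i : ℝ) / 2 ^ N ≤ (i + 1) / 2 ^ N := by gcongr; linarith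
    rcases le_or_gt i j with hij | hij
    · refine prism_eq_zero (S := S ×ˢ dyadic N i) (fun k => ⟨(hv k).1, ?_⟩)
        (fun k => ⟨(hv k).1, ?_⟩) (hω' i hi)
      all_goals
        have h3 : (i : ℝ) / 2 ^ N ≤ (v k).2 := by
          refine le_trans ?_ (hv k).2.1
          gcongr
        simp only [cutoff, dyadic, Set.mem_Icc, Nat.cast_add, Nat.cast_one]
      · exact ⟨le_min h3 le_rfl, (min_le_right _ _).trans hmono⟩
      · exact ⟨le_min h3 hmono, min_le_right _ _⟩
    · have h3 : ∀ k, (v k).2 ≤ i / 2 ^ N := fun k => by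
        refine (hv k).2.2.trans ?_
        gcongr
        exact_mod_cast hij
      refine prism_eq_zero (S := S ×ˢ dyadic N j) (fun k => ?_) (fun k => ?_) (hω' j hj)
      · rw [show cutoff (i / 2 ^ N) (v k) = v k from Prod.ext rfl (min_eq_left (h3 k))]
        exact hv k
      · rw [show cutoff ((i + 1 : ℕ) / 2 ^ N) (v k) = v k from
          Prod.ext rfl (min_eq_left ((h3 k).trans (by push_cast; exact hmono)))]
        exact hv k
  have h3 : cone (p, (0 : ℝ)) m ω ((fun y : X × ℝ => (y.1, min y.2 0)) ∘ v) = 0 := by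
    refine hω' 0 (by positivity) _ rfl _ fun i => ?_
    have h0 : (0 : ℝ) ∈ dyadic N 0 := by simp [dyadic]
    refine Fin.cases ⟨hp, h0⟩ (fun i => ?_) i
    have h4 : (0 : ℝ) ≤ (v i).2 := le_trans (by positivity) (hv i).2.1
    refine ⟨(hv i).1, ?_⟩
    simpa [min_eq_right h4] using h0
  simp only [cylinderContraction, LinearMap.add_apply, LinearMap.sum_apply, Pi.add_apply,
    LinearMap.comp_apply, pullback_apply, h1, h3, Finset.sum_apply, Finset.sum_eq_zero h2,
    add_zero]

end Interval

/-! ### Homotopy invariance with control of supports -/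

section HomotopyInvariance

open Topology Filter

variable {R : Type v} [Ring R] {X : Type u}

/-- The points `x` such that `(x, …, x)` does not lie in the closure of the support of `φ`. -/
def zeroLocus [TopologicalSpace X] {n : ℕ} (φ : Cochain R X n) : Set X :=
  {x | (fun _ => x) ∉ closure (Function.support φ)}

lemma mem_zeroLocus_iff [TopologicalSpace X] {n : ℕ} {φ : Cochain R X n} {x : X} :
    x ∈ zeroLocus φ ↔ ∃ U : Set X, IsOpen U ∧ x ∈ U ∧
      ∀ v : Fin (n + 1) → X, (∀ i, v i ∈ U) → φ v = 0 := by
  rw [zeroLocus, Set.mem_ofPred_eq, ← Set.mem_compl_iff, ← interior_compl, mem_interior_iff_mem_nhds,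
    nhds_pi, mem_pi]
  constructor
  · rintro ⟨I, -, t, ht, hsub⟩
    refine ⟨⋂ i, interior (t i), isOpen_iInter_of_finite fun i => isOpen_interior,
      Set.mem_iInter.2 fun i => mem_interior_iff_mem_nhds.2 (ht i), fun v hv => ?_⟩
    have := hsub (a := v) fun i _ => interior_subset (Set.mem_iInter.1 (hv i) i)
    simpa using this
  · rintro ⟨U, hU, hx, h⟩
    refine ⟨Set.univ, Set.finite_univ, fun _ => U, fun _ => hU.mem_nhds hx, fun v hv => ?_⟩
    have := h v fun i => hv i trivial
    simpa using this

section Metric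

variable [MetricSpace X]

/-- The cochain `ω` on the cylinder `X × ℝ` vanishes on the products of the ball of radius `2⁻ᴺ`
around `x` with the dyadic intervals of length `2⁻ᴺ` in `[0, 1]`. -/
def VanishesAtLevel {n : ℕ} (ω : Cochain R (X × ℝ) n) (x : X) (N : ℕ) : Prop :=
  VanishesOn ω (cylinders (Metric.ball x ((1 / 2) ^ N)) N)

/-- The least level at which `ω` vanishes near the fibre over `x`, if there is any. -/
noncomputable def level {n : ℕ} (ω : Cochain R (X × ℝ) n) (x : X) : ℕ :=
  sInf {N | VanishesAtLevel ω x N}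

/-- The fibre `{x} × [0, 1]` is compact, so a Lebesgue number of its cover by preimages of open sets
on which `φ` vanishes bounds the dyadic scale needed. -/
lemma exists_vanishesAtLevel {Y : Type*} [TopologicalSpace Y] {H : X × ℝ → Y} (hH : Continuous H)
    {n : ℕ} {φ : Cochain R Y n} {x : X} (hx : ∀ s ∈ Set.Icc (0 : ℝ) 1, H (x, s) ∈ zeroLocus φ) :
    ∃ N, VanishesAtLevel (pullback H n φ) x N := by
  choose! U hU hxU hUφ using fun s hs => mem_zeroLocus_iff.1 (hx s hs)
  have hK : IsCompact ((fun s : ℝ => (x, s)) '' Set.Icc 0 1) :=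
    isCompact_Icc.image (by fun_prop)
  obtain ⟨δ, hδ, h⟩ := lebesgue_number_lemma_of_metric (ι := Set.Icc (0 : ℝ) 1)
    (c := fun s => H ⁻¹' U s) hK (fun s => (hU s s.2).preimage hH) (by
      rintro _ ⟨s, hs, rfl⟩
      exact Set.mem_iUnion.2 ⟨⟨s, hs⟩, hxU s hs⟩)
  obtain ⟨N, hN⟩ := exists_pow_lt_of_lt_one hδ (show (1 / 2 : ℝ) < 1 by norm_num)
  refine ⟨N, ?_⟩
  rintro _ ⟨j, hj, rfl⟩ v hv
  have hpos : (0 : ℝ) < 2 ^ N := by positivity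
  have hj' : (j : ℝ) / 2 ^ N ∈ Set.Icc (0 : ℝ) 1 := by
    refine ⟨by positivity, ?_⟩
    rw [div_le_one hpos]
    exact_mod_cast hj.le
  obtain ⟨s, hs⟩ := h _ ⟨_, hj', rfl⟩
  refine hUφ s s.2 _ fun i => hs ?_
  rw [← ball_prod_same]
  refine ⟨Metric.ball_subset_ball hN.le (hv i).1, ?_⟩
  have h1 := (hv i).2.1
  have h2 := (hv i).2.2
  rw [add_div, one_div, ← inv_pow, ← one_div] at h2
  rw [Metric.mem_ball, Real.dist_eq, abs_lt]
  constructor <;> linarith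

lemma VanishesAtLevel.of_dist {n : ℕ} {ω : Cochain R (X × ℝ) n} {x y : X} {N : ℕ}
    (h : VanishesAtLevel ω x N) (hxy : dist y x < (1 / 2) ^ (N + 1)) :
    VanishesAtLevel ω y (N + 1) := by
  refine VanishesOn.mono h (cylinders_mono ?_ (Nat.le_succ N))
  refine Metric.ball_subset_ball' ?_
  rw [pow_succ] at hxy ⊢
  linarith

/-- The homotopy between the two ends of the cylinder whose carriers are adapted to `ω`. -/
noncomputable def cylinderHomotopy {m : ℕ} (ω : Cochain R (X × ℝ) m) :
    ∀ n, Cochain R (X × ℝ) (n + 1) →ₗ[R] Cochain R X n :=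
  carrierHomotopy (fun _ σ => cylinderContraction (⨅ i, level ω (σ i)) (σ 0))
    (fun x => (x, 0)) (fun x => (x, 1))

lemma cylinderHomotopy_eq_zero {m : ℕ} {ω : Cochain R (X × ℝ) m} {n : ℕ} (σ : Fin (n + 1) → X)
    (η : Cochain R (X × ℝ) (n + 1))
    (h : VanishesOn η (cylinders (Set.range σ) (⨅ i, level ω (σ i)))) :
    cylinderHomotopy ω n η σ = 0 := by
  refine carrierHomotopy_eq_zero (fun n σ => cylinders (Set.range σ) (⨅ i, level ω (σ i)))
    ?_ ?_ ?_ ?_ n σ η h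
  · intro n σ i
    refine cylinders_mono ?_ ?_
    · rintro _ ⟨k, rfl⟩; exact ⟨_, rfl⟩
    -- A face has fewer vertices, hence a larger minimal level and finer intervals.
    · exact le_ciInf fun k => ciInf_le (OrderBot.bddBelow _) _
  · intro n σ
    refine ⟨_, ⟨0, by positivity, rfl⟩, fun i => ⟨⟨i, rfl⟩, ?_⟩⟩
    simp [dyadic]
  · intro n σ
    generalize (⨅ i, level ω (σ i)) = N
    have hpos : (0 : ℝ) < 2 ^ N := by positivity
    have h1 : 1 ≤ 2 ^ N := Nat.one_le_two_pow
    -- The last dyadic interval is the one containing height 1.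
    refine ⟨_, ⟨2 ^ N - 1, by omega, rfl⟩, fun i => ⟨⟨i, rfl⟩, ?_⟩⟩
    simp only [dyadic, Set.mem_Icc]
    push_cast [Nat.cast_sub h1]
    rw [div_le_one hpos, le_div_iff₀ hpos]
    constructor <;> linarith
  · exact fun n σ m η hη => hη.cylinderContraction_op (Set.mem_range_self 0)

/-- Near `x` levels exceed `level ω x` by at most one, although they need not be continuous. The
vertex of smallest level then controls a small simplex: its ball contains all the vertices. -/
lemma mem_zeroLocus_cylinderHomotopy {n : ℕ} {ω : Cochain R (X × ℝ) (n + 1)} {x : X}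
    (h : ∃ N, VanishesAtLevel ω x N) : x ∈ zeroLocus (cylinderHomotopy ω n ω) := by
  have hx : VanishesAtLevel ω x (level ω x) := Nat.sInf_mem h
  -- The exponent is `+ 2` because two vertices may be twice the radius apart, and that must stay
  -- below `2^-(level ω x + 1)`.
  refine mem_zeroLocus_iff.2 ⟨Metric.ball x ((1 / 2) ^ (level ω x + 2)), Metric.isOpen_ball,
    Metric.mem_ball_self (by positivity), fun σ hσ => cylinderHomotopy_eq_zero _ _ ?_⟩
  have hnear : ∀ i, VanishesAtLevel ω (σ i) (level ω x + 1) := fun i =>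
    hx.of_dist ((Metric.mem_ball.1 (hσ i)).trans
      (pow_lt_pow_right_of_lt_one₀ (by norm_num) (by norm_num) (by omega)))
  obtain ⟨j, hj⟩ := exists_eq_ciInf_of_finite (f := fun i => level ω (σ i))
  rw [← hj]
  have hle : level ω (σ j) ≤ level ω x + 1 := Nat.sInf_le (hnear j)
  have hvan : VanishesAtLevel ω (σ j) (level ω (σ j)) :=
    Nat.sInf_mem (s := {N | VanishesAtLevel ω (σ j) N}) ⟨_, hnear j⟩
  refine VanishesOn.mono hvan (cylinders_mono ?_ le_rfl)
  rintro _ ⟨i, rfl⟩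
  rw [Metric.mem_ball]
  calc dist (σ i) (σ j) ≤ dist (σ i) x + dist (σ j) x := dist_triangle_right _ _ _
    _ < (1 / 2) ^ (level ω x + 2) + (1 / 2) ^ (level ω x + 2) := add_lt_add (hσ i) (hσ j)
    _ = (1 / 2) ^ (level ω x + 1) := by ring
    _ ≤ (1 / 2) ^ level ω (σ j) := pow_le_pow_of_le_one (by norm_num) (by norm_num) hle

/-- The ends of a homotopy pull a cocycle back to cohomologous cocycles, with control on the
support of the cochain between them. -/
theorem exists_homotopy_cochain {Y : Type*} [TopologicalSpace Y] {H : X × ℝ → Y}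
    (hH : Continuous H) {n : ℕ} {φ : Cochain R Y (n + 1)} (hφ : d R Y (n + 1) φ = 0) :
    ∃ χ : Cochain R X n,
      d R X n χ = pullback (fun x => H (x, 1)) (n + 1) φ - pullback (fun x => H (x, 0)) (n + 1) φ ∧
      {x | ∀ s ∈ Set.Icc (0 : ℝ) 1, H (x, s) ∈ zeroLocus φ} ⊆ zeroLocus χ := by
  refine ⟨cylinderHomotopy (pullback H (n + 1) φ) n (pullback H (n + 1) φ), ?_, fun x hx =>
    mem_zeroLocus_cylinderHomotopy (exists_vanishesAtLevel hH hx)⟩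
  have h := carrierHomotopy_d_succ
    (fun _ σ => cylinderContraction (⨅ i, level (pullback H (n + 1) φ) (σ i)) (σ 0))
    (fun x => (x, (0 : ℝ))) (fun x => (x, 1)) n (pullback H (n + 1) φ)
  rw [d_pullback, hφ, map_zero, map_zero, zero_add] at h
  exact h

end Metric

end HomotopyInvariance

lemma Subcomplex.ext {R : Type v} [Ring R] {X : Type u} {A B : Subcomplex R X}
    (h : ∀ n, A.carrier n = B.carrier n) : A = B := by
  cases A
  cases B
  congr
  exact funext h

/-- A subcomplex of cochains in which every cocycle is a coboundary, also in degree zero. -/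
structure Subcomplex.IsAcyclic {R : Type v} [Ring R] {X : Type u} (A : Subcomplex R X) : Prop where
  eq_zero : ∀ φ ∈ A.carrier 0, d R X 0 φ = 0 → φ = 0
  exists_eq_d : ∀ n, ∀ φ ∈ A.carrier (n + 1), d R X (n + 1) φ = 0 →
    ∃ ψ ∈ A.carrier n, d R X n ψ = φ

lemma eq_of_d_eq_zero {R : Type v} [Ring R] {X : Type u} {φ : Cochain R X 0} (h : d R X 0 φ = 0) (v w : Fin 1 → X) :
    φ v = φ w := by
  have h1 := cone_d_zero (w 0) φ v
  rw [h] at h1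
  have h2 : (fun _ => w 0) = w := funext fun i => by rw [Subsingleton.elim i 0]
  rw [h2] at h1
  exact sub_eq_zero.1 (h1.symm.trans rfl)

/-! ### Support conditions given by filters -/

section Supports

open Filter

variable (R : Type v) [Ring R] {X : Type u} [TopologicalSpace X]

variable {R} in
lemma zeroLocus_add {n : ℕ} (φ ψ : Cochain R X n) :
    zeroLocus φ ∩ zeroLocus ψ ⊆ zeroLocus (φ + ψ) := by
  intro x hx h
  have := closure_mono (Function.support_add φ ψ) h
  rw [closure_union] at this
  exact this.elim hx.1 hx.2

variable {R} in
lemma zeroLocus_mono {n : ℕ} {φ ψ : Cochain R X n}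
    (h : Function.support ψ ⊆ Function.support φ) : zeroLocus φ ⊆ zeroLocus ψ :=
  fun _ hx hx' => hx (closure_mono h hx')

variable {R} in
lemma zeroLocus_d {n : ℕ} (φ : Cochain R X n) : zeroLocus φ ⊆ zeroLocus (d R X n φ) := by
  intro x hx h
  obtain ⟨y, hy, hyx⟩ := diagSupport_d φ (const_mem_diagSupport.2 h)
  obtain ⟨z, rfl⟩ := hy.1
  obtain rfl : z = x := congrFun hyx 0
  exact hx hy.2

/-- The cochains `φ` whose diagonal support `‖φ‖` avoids a member of the filter `F`. -/
def supported (F : Filter X) : Subcomplex R X where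
  carrier n :=
    { carrier := {φ | zeroLocus φ ∈ F}
      zero_mem' := mem_of_superset univ_mem fun x _ => by simp [zeroLocus]
      add_mem' := fun {φ ψ} hφ hψ => mem_of_superset (inter_mem hφ hψ) (zeroLocus_add φ ψ)
      smul_mem' := fun r φ hφ => mem_of_superset (x := zeroLocus φ) hφ (zeroLocus_mono
        fun v hv h0 => hv (by simp [h0])) }
  d_mem n φ hφ := mem_of_superset (x := zeroLocus φ) hφ (zeroLocus_d φ)

variable {R}

lemma mem_supported {F : Filter X} {n : ℕ} {φ : Cochain R X n} :
    φ ∈ (supported R F).carrier n ↔ zeroLocus φ ∈ F := Iff.rfl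

lemma zeroLocus_eq_univ_iff {n : ℕ} {φ : Cochain R X n} :
    zeroLocus φ = Set.univ ↔ diagSupport φ = ∅ := by
  rw [Set.eq_univ_iff_forall, Set.eq_empty_iff_forall_notMem]
  constructor
  · rintro h _ ⟨⟨x, rfl⟩, hx⟩
    exact h x hx
  · exact fun h x hx => h _ (const_mem_diagSupport.2 hx)

lemma locallyZero_eq_supported : locallyZero R X = supported R (⊤ : Filter X) :=
  Subcomplex.ext fun _ => Submodule.ext fun _ => zeroLocus_eq_univ_iff.symm.trans mem_top.symm

lemma eq_of_mem_zeroLocus {φ : Cochain R X 0} {v : Fin 1 → X} (h : v 0 ∈ zeroLocus φ) :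
    φ v = 0 := by
  obtain ⟨U, -, hU, h⟩ := mem_zeroLocus_iff.1 h
  exact h v fun i => by rwa [Subsingleton.elim (α := Fin 1) i 0]

end Supports

/-! ### Acyclicity from contractions and pushes -/

section Acyclic

open Filter

variable {R : Type v} [Ring R] {X : Type u} [MetricSpace X]

variable (R X) in
-- A contraction links the identity to a constant map, along which a locally zero cochain pulls back
-- to zero. In degree 0 every tuple is diagonal, so locally zero means zero.
theorem isAcyclic_supported_top [ContractibleSpace X] :
    (supported R (⊤ : Filter X)).IsAcyclic where
  eq_zero φ hφ _ := by
    funext v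
    have : v 0 ∈ zeroLocus φ := by rw [mem_top.1 hφ]; trivial
    exact eq_of_mem_zeroLocus this
  exists_eq_d n φ hφ hd := by
    have huniv : ∀ x, x ∈ zeroLocus φ := Set.eq_univ_iff_forall.1 (mem_top.1 hφ)
    obtain ⟨b, ⟨G⟩⟩ := id_nullhomotopic X
    let H : X × ℝ → X := fun y => G (Set.projIcc 0 1 zero_le_one y.2, y.1)
    have hH : Continuous H :=
      G.continuous.comp ((continuous_projIcc.comp continuous_snd).prodMk continuous_fst)
    obtain ⟨χ, hχ, hzero⟩ := exists_homotopy_cochain hH hd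
    have h0 : (fun x => H (x, 0)) = id := by
      funext x; simp [H]
    have h1 : (fun x => H (x, 1)) = fun _ => b := by
      funext x; simp [H]
    refine ⟨-χ, ?_, ?_⟩
    · refine Submodule.neg_mem _ (mem_top.2 ?_)
      exact Set.eq_univ_of_univ_subset fun x _ => hzero fun s _ => huniv _
    · rw [map_neg, hχ, h0, h1]
      have : pullback (fun _ : X => b) (n + 1) φ = 0 := by
        funext v
        obtain ⟨U, -, hb, hU⟩ := mem_zeroLocus_iff.1 (huniv b)
        exact hU _ fun _ => hb
      rw [this, zero_sub, neg_neg]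
      rfl

/-- If the members of `F` can be reached by homotopies that respect `F` then the cochains
supported away from `F` form an acyclic complex. -/
theorem isAcyclic_supported [ContractibleSpace X] {F : Filter X}
    (hF : ∀ U ∈ F, ∃ H : X × ℝ → X, Continuous H ∧ (∀ x, H (x, 1) = x) ∧ (∀ x, H (x, 0) ∈ U) ∧
      {x | ∀ s ∈ Set.Icc (0 : ℝ) 1, H (x, s) ∈ U} ∈ F) :
    (supported R F).IsAcyclic where
  eq_zero φ hφ hd := by
    obtain ⟨H, -, -, h0, -⟩ := hF _ hφ
    funext v
    -- A 0-cocycle is constant, so one zero suffices.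
    rw [eq_of_d_eq_zero hd v (fun _ => H (v 0, 0))]
    exact eq_of_mem_zeroLocus (h0 _)
  exists_eq_d n φ hφ hd := by
    obtain ⟨H, hH, h1, h0, hs⟩ := hF _ hφ
    obtain ⟨χ, hχ, hzero⟩ := exists_homotopy_cochain hH hd
    -- The end at 0 lands where `φ` is locally zero, so its pullback is locally zero everywhere and
    -- hence exact.
    have hmem : pullback (fun x => H (x, 0)) (n + 1) φ ∈ (supported R ⊤).carrier (n + 1) := by
      refine mem_top.2 (Set.eq_univ_iff_forall.2 fun x => mem_zeroLocus_iff.2 ?_)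
      obtain ⟨U, hU, hx, h⟩ := mem_zeroLocus_iff.1 (h0 x)
      exact ⟨_, hU.preimage (f := fun x => H (x, 0)) (by fun_prop), hx, fun v hv => h _ hv⟩
    obtain ⟨ψ, hψ, hdψ⟩ := (isAcyclic_supported_top R X).exists_eq_d n _ hmem
      (by rw [d_pullback, hd, map_zero])
    refine ⟨χ + ψ, Submodule.add_mem _ (mem_of_superset hs hzero) ?_, ?_⟩
    · exact mem_of_superset univ_mem (Set.univ_subset_iff.2 (mem_top.1 hψ))
    · rw [map_add, hχ, hdψ, sub_add_cancel, show (fun x => H (x, 1)) = id from funext h1]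
      rfl

end Acyclic

/-! ### Cohomology as cocycles modulo coboundaries -/

section Cohomology

variable {R : Type v} [Ring R] {X : Type u}

namespace Subcomplex

/-- The cocycles of a subcomplex. -/
def cocycles (A : Subcomplex R X) (n : ℕ) : Submodule R (Cochain R X n) :=
  A.carrier n ⊓ LinearMap.ker (d R X n)

/-- The coboundaries of a subcomplex. -/
def coboundaries (A : Subcomplex R X) : ∀ n, Submodule R (Cochain R X n)
  | 0 => ⊥
  | n + 1 => (A.carrier n).map (d R X n)

/-- The cohomology of a subcomplex as cocycles modulo coboundaries. -/
abbrev cohomology (A : Subcomplex R X) (n : ℕ) : Type (max u v) :=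
  A.cocycles n ⧸ (A.coboundaries n).submoduleOf (A.cocycles n)

/-- The cocycles as the kernel of the differential of the complex. -/
noncomputable def cocyclesToKer (A : Subcomplex R X) (n m : ℕ) (h : n + 1 = m) :
    A.cocycles n →ₗ[R] LinearMap.ker (A.complex.d n m).hom :=
  LinearMap.codRestrict _ (Submodule.inclusion (inf_le_left : A.cocycles n ≤ A.carrier n)) (by
    subst h
    rintro ⟨φ, hφ⟩
    rw [LinearMap.mem_ker, complex_d]
    exact Subtype.ext hφ.2)

lemma cocyclesToKer_surjective (A : Subcomplex R X) (n m : ℕ) (h : n + 1 = m) :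
    Function.Surjective (A.cocyclesToKer n m h) := by
  subst h
  rintro ⟨φ, hφ⟩
  rw [LinearMap.mem_ker, complex_d] at hφ
  exact ⟨⟨φ.1, φ.2, congrArg Subtype.val hφ⟩, rfl⟩

lemma nonempty_homology_equiv (A : Subcomplex R X) (n : ℕ) :
    Nonempty (A.complex.homology n ≃ₗ[R] A.cohomology n) := by
  let S := A.complex.sc' ((ComplexShape.up ℕ).prev n) n (n + 1)
  let q : A.cocycles n →ₗ[R] (LinearMap.ker S.g.hom ⧸ LinearMap.range S.moduleCatToCycles) :=
    (LinearMap.range S.moduleCatToCycles).mkQ ∘ₗ A.cocyclesToKer n (n + 1) rfl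
  have hq : Function.Surjective q :=
    (Submodule.mkQ_surjective _).comp (A.cocyclesToKer_surjective n (n + 1) rfl)
  have hker : (A.coboundaries n).submoduleOf (A.cocycles n) = LinearMap.ker q := by
    ext φ
    have hq0 : q φ = 0 ↔ ∃ y, S.moduleCatToCycles y = A.cocyclesToKer n (n + 1) rfl φ :=
      Submodule.Quotient.mk_eq_zero _
    rw [LinearMap.mem_ker, hq0, Submodule.submoduleOf, Submodule.mem_comap]
    cases n with
    | zero =>
      -- In degree 0 the predecessor is the default value 0, and the map `0 → 0` is zero by shape.
      have hS : S.f = 0 := A.complex.shape _ _ (by simp)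
      have h0 : ∀ y, S.moduleCatToCycles y = 0 := fun y => Subtype.ext (by
        change S.f.hom y = 0
        rw [hS]; rfl)
      simp only [h0, exists_const]
      constructor
      · intro h
        exact (Subtype.ext (Subtype.ext h.symm))
      · intro h
        exact (congrArg (fun z => z.1.1) h).symm
    | succ n =>
      have hprev : (ComplexShape.up ℕ).prev (n + 1) = n := by simp
      -- The predecessor equals `n` only propositionally, so it is generalised before `complex_d` is
      -- used.
      have key : ∀ m (_ : m = n), (∃ y, (A.complex.d m (n + 1)).hom y
          = (A.cocyclesToKer (n + 1) (n + 1 + 1) rfl φ).1)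
          ↔ (A.cocycles (n + 1)).subtype φ ∈ A.coboundaries (n + 1) := by
        rintro m rfl
        rw [complex_d]
        constructor
        · rintro ⟨y, hy⟩
          exact ⟨y.1, y.2, congrArg Subtype.val hy⟩
        · rintro ⟨y, hy, h⟩
          exact ⟨⟨y, hy⟩, Subtype.ext h⟩
      rw [← key _ hprev]
      exact exists_congr fun y => ⟨fun h => Subtype.ext h, fun h => congrArg Subtype.val h⟩
  exact ⟨(A.complex.homologyIsoSc' _ n (n + 1) rfl (by simp)
    ≪≫ S.moduleCatHomologyIso).toLinearEquiv.trans
      ((Submodule.quotEquivOfEq _ _ hker).trans (q.quotKerEquivOfSurjective hq)).symm⟩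

end Subcomplex

end Cohomology

/-! ### Mayer-Vietoris for two acyclic subcomplexes -/

section Acyclic

variable {R : Type v} [Ring R] {X : Type u}

lemma Subcomplex.IsAcyclic.subsingleton_cohomology {A : Subcomplex R X} (hA : A.IsAcyclic)
    (n : ℕ) : Subsingleton (A.cohomology n) := by
  refine Submodule.Quotient.subsingleton_iff.2 (eq_top_iff.2 ?_)
  rintro ⟨φ, hφ, hd⟩ -
  cases n with
  | zero => exact hA.eq_zero φ hφ hd
  | succ n => exact hA.exists_eq_d n φ hφ hd

lemma Subcomplex.IsAcyclic.isZero_homology {A : Subcomplex R X} (hA : A.IsAcyclic) (n : ℕ) :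
    Limits.IsZero (A.complex.homology n) := by
  obtain ⟨e⟩ := A.nonempty_homology_equiv n
  have := hA.subsingleton_cohomology n
  have := e.toEquiv.subsingleton
  exact ModuleCat.isZero_of_subsingleton _

variable {A B C S : Subcomplex R X}

lemma subsingleton_cohomology_zero (hAC : C ≤ A) (hA : A.IsAcyclic) :
    Subsingleton (C.cohomology 0) := by
  refine Submodule.Quotient.subsingleton_iff.2 (eq_top_iff.2 ?_)
  rintro ⟨φ, hφ, hd⟩ -
  exact hA.eq_zero φ (hAC 0 hφ) hd

/-- The connecting isomorphism of the Mayer-Vietoris sequence of two acyclic complexes `A`, `B`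
with intersection `C` and sum `S`. -/
theorem nonempty_cohomology_equiv_succ (hC : ∀ n, C.carrier n = A.carrier n ⊓ B.carrier n)
    (hAS : A ≤ S) (hBS : B ≤ S) (ρ : ∀ n, Cochain R X n →ₗ[R] Cochain R X n)
    (hρA : ∀ n, ∀ φ ∈ S.carrier n, ρ n φ ∈ A.carrier n)
    (hρB : ∀ n, ∀ φ ∈ S.carrier n, φ - ρ n φ ∈ B.carrier n)
    (hA : A.IsAcyclic) (hB : B.IsAcyclic) (n : ℕ) :
    Nonempty (S.cohomology n ≃ₗ[R] C.cohomology (n + 1)) := by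
  -- `ρ` need not commute with `d`, but for a cocycle `d (ρ φ) = -d (φ - ρ φ)`, which lies in both
  -- `A` and `B`.
  have hmem : ∀ φ ∈ S.cocycles n, d R X n (ρ n φ) ∈ C.cocycles (n + 1) := by
    rintro φ ⟨hφ, hd⟩
    refine ⟨?_, d_d _⟩
    rw [hC]
    refine ⟨A.d_mem _ _ (hρA n φ hφ), ?_⟩
    have := Submodule.neg_mem _ (B.d_mem _ _ (hρB n φ hφ))
    rwa [map_sub, LinearMap.mem_ker.1 hd, zero_sub, neg_neg] at this
  let δ : S.cocycles n →ₗ[R] C.cohomology (n + 1) :=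
    Submodule.mkQ _ ∘ₗ (d R X n ∘ₗ ρ n).restrict hmem
  have hδ : ∀ φ, δ φ = 0 ↔ ∃ β ∈ C.carrier n, d R X n β = d R X n (ρ n φ.1) := by
    intro φ
    rw [LinearMap.comp_apply, Submodule.mkQ_apply, Submodule.Quotient.mk_eq_zero]
    rfl
  have hsurj : Function.Surjective δ := by
    intro ω
    obtain ⟨⟨ω, hω, hd⟩, rfl⟩ := Submodule.Quotient.mk_surjective _ ω
    rw [hC] at hω
    obtain ⟨α, hα, hdα⟩ := hA.exists_eq_d n ω hω.1 hd
    obtain ⟨β, hβ, hdβ⟩ := hB.exists_eq_d n ω hω.2 hd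
    have hαS := hAS n hα
    have hβS := hBS n hβ
    refine ⟨⟨α - β, Submodule.sub_mem _ hαS hβS, ?_⟩, ?_⟩
    · exact LinearMap.mem_ker.2 (by rw [map_sub, hdα, hdβ, sub_self])
    · rw [LinearMap.comp_apply, Submodule.mkQ_apply]
      refine (Submodule.Quotient.eq _).2 ?_
      -- The splitting `α - β` of the cocycle and the splitting by `ρ` differ by this element of
      -- `C`.
      refine ⟨-(α - ρ n α) - ρ n β, ?_, ?_⟩
      · rw [hC]
        refine ⟨Submodule.sub_mem _ (Submodule.neg_mem _ (Submodule.sub_mem _ hα (hρA n α hαS)))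
          (hρA n β hβS), ?_⟩
        have : -(α - ρ n α) - ρ n β = -(α - ρ n α) + (β - ρ n β) - β := by abel
        rw [this]
        exact Submodule.sub_mem _ (Submodule.add_mem _ (Submodule.neg_mem _ (hρB n α hαS))
          (hρB n β hβS)) hβ
      · change _ = d R X n (ρ n (α - β)) - ω
        rw [← hdα]
        simp only [map_sub, map_neg]
        abel
  have hker : (S.coboundaries n).submoduleOf (S.cocycles n) = LinearMap.ker δ := by
    ext φ
    rw [LinearMap.mem_ker, hδ, Submodule.submoduleOf, Submodule.mem_comap]
    obtain ⟨φ, hφ, hd⟩ := φ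
    constructor
    · intro h
      cases n with
      | zero =>
        obtain rfl : φ = 0 := h
        exact ⟨0, Submodule.zero_mem _, by simp⟩
      | succ n =>
        obtain ⟨η, hη, rfl⟩ : ∃ η ∈ S.carrier n, d R X n η = φ := h
        -- The failure of `ρ` to commute with `d` lies in `C`, since it is up to sign the same
        -- failure for `1 - ρ`.
        refine ⟨ρ (n + 1) (d R X n η) - d R X n (ρ n η), ?_, ?_⟩
        · rw [hC]
          refine ⟨Submodule.sub_mem _ (hρA _ _ hφ) (A.d_mem _ _ (hρA _ _ hη)), ?_⟩
          have : ρ (n + 1) (d R X n η) - d R X n (ρ n η)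
              = d R X n (η - ρ n η) - (d R X n η - ρ (n + 1) (d R X n η)) := by
            rw [map_sub]; abel
          rw [this]
          exact Submodule.sub_mem _ (B.d_mem _ _ (hρB _ _ hη)) (hρB _ _ hφ)
        · rw [map_sub, d_d, sub_zero]
    · rintro ⟨β, hβ, hdβ⟩
      rw [hC] at hβ
      have hd0 : d R X n φ = 0 := hd
      have h1 : d R X n (ρ n φ - β) = 0 := by rw [map_sub, hdβ, sub_self]
      have h2 : d R X n (φ - ρ n φ + β) = 0 := by
        rw [map_add, map_sub, hdβ, hd0]; abel
      have h3 := Submodule.sub_mem _ (hρA n φ hφ) hβ.1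
      have h4 := Submodule.add_mem _ (hρB n φ hφ) hβ.2
      have h5 : φ = (ρ n φ - β) + (φ - ρ n φ + β) := by abel
      cases n with
      | zero =>
        rw [hA.eq_zero _ h3 h1, hB.eq_zero _ h4 h2, add_zero] at h5
        exact h5
      | succ n =>
        obtain ⟨a, ha, hda⟩ := hA.exists_eq_d n _ h3 h1
        obtain ⟨b, hb, hdb⟩ := hB.exists_eq_d n _ h4 h2
        refine ⟨a + b, Submodule.add_mem _ (hAS n ha) (hBS n hb), ?_⟩
        rw [map_add, hda, hdb]
        exact h5.symm
  exact ⟨(Submodule.quotEquivOfEq _ _ hker).trans (δ.quotKerEquivOfSurjective hsurj)⟩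

end Acyclic

/-! ### Bounded versus compact supports -/

section CompactSupport

variable {R : Type v} [Ring R] {X : Type u}

/-- The short complex of a subcomplex and the quotient by it. -/
noncomputable def Subcomplex.shortComplex {A B : Subcomplex R X} (h : A ≤ B) :
    ShortComplex (CochainComplex (ModuleCat.{max u v} R) ℕ) :=
  ShortComplex.mk (Subcomplex.inclusion h) (Subcomplex.projection h) (by
    ext n φ
    exact (Submodule.Quotient.mk_eq_zero _).2 φ.2)

lemma Subcomplex.shortComplex_shortExact {A B : Subcomplex R X} (h : A ≤ B) :
    (Subcomplex.shortComplex h).ShortExact :=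
  HomologicalComplex.shortExact_of_degreewise_shortExact _ fun n =>
    { exact := by
        rw [ShortComplex.moduleCat_exact_iff]
        intro φ hφ
        have : φ ∈ (A.carrier n).submoduleOf (B.carrier n) :=
          (Submodule.Quotient.mk_eq_zero _).1 hφ
        exact ⟨⟨φ.1, this⟩, rfl⟩
      mono_f := (ModuleCat.mono_iff_injective _).2 (Submodule.inclusion_injective (h n))
      epi_g := (ModuleCat.epi_iff_surjective _).2 (Submodule.mkQ_surjective _) }

/-- Long exact sequence: `Hᵏ(A) = 0` gives injectivity and `Hᵏ⁺¹(A) = 0` surjectivity. -/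
lemma isIso_homologyMap_projection {A B : Subcomplex R X} (h : A ≤ B)
    (hA : A.IsAcyclic) (k : ℕ) :
    IsIso (HomologicalComplex.homologyMap (Subcomplex.projection h) k) := by
  have hS := Subcomplex.shortComplex_shortExact h
  have h1 : Mono (HomologicalComplex.homologyMap (Subcomplex.projection h) k) :=
    (hS.homology_exact₂ k).mono_g ((hA.isZero_homology k).eq_of_src _ _)
  have h2 : Epi (HomologicalComplex.homologyMap (Subcomplex.projection h) k) :=
    (hS.homology_exact₃ k (k + 1) rfl).epi_f ((hA.isZero_homology (k + 1)).eq_of_tgt _ _)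
  exact isIso_of_mono_of_epi _

lemma isIso_homologyMap_inclusion {A B : Subcomplex R X} (h : A ≤ B) (h' : B ≤ A) (k : ℕ) :
    IsIso (HomologicalComplex.homologyMap (Subcomplex.inclusion h) k) := by
  have : IsIso (Subcomplex.inclusion h) :=
    ⟨Subcomplex.inclusion h', by ext n φ; rfl, by ext n φ; rfl⟩
  infer_instance

lemma boundedlySupported_le_compactlySupported [MetricSpace X] [ProperSpace X] :
    boundedlySupported R X ≤ compactlySupported R X :=
  fun _ φ hφ => Metric.isCompact_of_isClosed_isBounded (isClosed_diagSupport φ) hφ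

theorem exists_Hb_iso_Hc (R : Type v) [Ring R] (X : Type u) [MetricSpace X] [ProperSpace X]
    [ContractibleSpace X] (k : ℕ) :
    ∃ e : Hb R X k ≅ Hc R X k, compactToHb R X k ≫ e.hom = compactToHc R X k := by
  have h1 : IsIso (compactToHb R X k) :=
    isIso_homologyMap_inclusion _ boundedlySupported_le_compactlySupported k
  have h2 : IsIso (compactToHc R X k) := by
    refine isIso_homologyMap_projection _ ?_ k
    rw [locallyZero_eq_supported]
    exact isAcyclic_supported_top R X
  exact ⟨(asIso (compactToHb R X k)).symm ≪≫ asIso (compactToHc R X k), by simp⟩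

end CompactSupport

/-! ### Uniform contractibility implies the version at infinity -/

section UniformContractibility

variable {X : Type u}

lemma ContractibleInside.mono [TopologicalSpace X] {A B D : Set X} (h : ContractibleInside B D)
    (hAB : A ⊆ B) : ContractibleInside A D := by
  obtain ⟨hBD, hn⟩ := h
  exact ⟨hAB.trans hBD, hn.comp_left ⟨Set.inclusion hAB, continuous_inclusion hAB⟩⟩

lemma contractibleInside_univ [TopologicalSpace X] [ContractibleSpace X] (B : Set X) :
    ContractibleInside B Set.univ := by
  refine ⟨Set.subset_univ _, ?_⟩
  exact ((id_nullhomotopic X).comp_left ⟨Subtype.val, continuous_subtype_val⟩).comp_right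
    (⟨fun x => ⟨x, trivial⟩, by fun_prop⟩ : C(X, (Set.univ : Set X)))

/-- In an unbounded connected metric space a bounded set can be enlarged to have any larger
diameter. -/
lemma exists_superset_diam_eq [MetricSpace X] [PreconnectedSpace X]
    (hX : ¬ Bornology.IsBounded (Set.univ : Set X)) {B : Set X} (hB : B.Nonempty)
    (hb : Bornology.IsBounded B) {r : ℝ} (hr : Metric.diam B ≤ r) :
    ∃ B' : Set X, B ⊆ B' ∧ Bornology.IsBounded B' ∧ Metric.diam B' = r := by
  obtain ⟨b, hbB⟩ := hB
  -- This makes the diameter of `insert x B` 1-Lipschitz in `x`, so the intermediate value theorem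
  -- yields the diameter `r`.
  have hle : ∀ x y, Metric.diam (insert x B) ≤ Metric.diam (insert y B) + dist x y := by
    intro x y
    have hy : Bornology.IsBounded (insert y B) := hb.insert y
    have hxz : ∀ z ∈ B, dist x z ≤ Metric.diam (insert y B) + dist x y := fun z hz => by
      have h1 := dist_triangle x y z
      have h2 := Metric.dist_le_diam_of_mem hy (Set.mem_insert y B) (Set.mem_insert_of_mem y hz)
      linarith
    have h0 : (0 : ℝ) ≤ Metric.diam (insert y B) + dist x y :=
      add_nonneg Metric.diam_nonneg dist_nonneg
    refine Metric.diam_le_of_forall_dist_le h0 ?_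
    rintro p (rfl | hp) q (rfl | hq)
    · rwa [dist_self]
    · exact hxz q hq
    · rw [dist_comm]; exact hxz p hp
    · exact (Metric.dist_le_diam_of_mem hy (Set.mem_insert_of_mem y hp)
        (Set.mem_insert_of_mem y hq)).trans (le_add_of_nonneg_right dist_nonneg)
  have hcont : Continuous fun x => Metric.diam (insert x B) :=
    (LipschitzWith.of_le_add hle).continuous
  have hlarge : ∃ x, r ≤ Metric.diam (insert x B) := by
    by_contra! h
    refine hX ((Metric.isBounded_closedBall (x := b) (r := r)).subset fun x _ => ?_)
    exact (Metric.dist_le_diam_of_mem (hb.insert x) (Set.mem_insert x B)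
      (Set.mem_insert_of_mem x hbB)).trans (h x).le
  obtain ⟨x, hx⟩ := mem_range_of_exists_le_of_exists_ge hcont
    ⟨b, by rwa [Set.insert_eq_of_mem hbB]⟩ hlarge
  exact ⟨_, Set.subset_insert x B, hb.insert x, hx⟩

theorem UniformlyContractible.atInfinity [MetricSpace X] [ContractibleSpace X]
    (h : UniformlyContractible X) : UniformlyContractibleAtInfinity X := by
  obtain ⟨b⟩ : Nonempty X := inferInstance
  by_cases hX : Bornology.IsBounded (Set.univ : Set X)
  · refine ⟨fun _ => ⟨Metric.diam (Set.univ : Set X), Metric.diam_nonneg⟩, fun _ => 0,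
      monotone_const, monotone_const, b, fun r B _ _ _ _ => ⟨Set.univ, hX, le_rfl,
        contractibleInside_univ B⟩⟩
  · obtain ⟨ρ, hρ⟩ := h
    -- The infimum over all `t ≥ s` is nondecreasing in `s`; adding 1 leaves room to pick a `t` with
    -- `ρ t` below the bound, and the set is then enlarged to diameter `t`.
    refine ⟨fun s => sInf (ρ '' Set.Ici s) + 1, fun _ => 0, ?_, monotone_const, b, ?_⟩
    · intro s t hst
      exact add_le_add_left (csInf_le_csInf (OrderBot.bddBelow _) (Set.nonempty_Ici.image ρ)
        (Set.image_mono (Set.Ici_subset_Ici.2 hst))) 1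
    · intro r B hB hb hr _
      obtain ⟨_, ⟨t, ht, rfl⟩, hlt⟩ := exists_lt_of_csInf_lt
        ((Set.nonempty_Ici (a := r)).image ρ) (lt_add_one (sInf (ρ '' Set.Ici r)))
      obtain ⟨B', hBB', hb', hd'⟩ := exists_superset_diam_eq hX hB hb
        (r := t) (by rw [hr]; exact_mod_cast ht)
      obtain ⟨D, hD, hDd, hc⟩ := hρ t B' (hB.mono hBB') hb' hd'
      exact ⟨D, hD, hDd.trans (by exact_mod_cast hlt.le), hc.mono hBB'⟩

end UniformContractibility

/-! ### Boundedly supported cohomology of Euclidean space -/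

section Euclidean

open Filter Bornology

/-- The filter on `ℝⁿ` generated by the complements of the sets on which the first `j`
coordinates are bounded. -/
def coordFilter (n j : ℕ) : Filter (EuclideanSpace ℝ (Fin n)) :=
  ⨆ i : Fin n, ⨆ _ : i.val < j, comap (fun x => x i) (cobounded ℝ)

lemma mem_coordFilter {n j : ℕ} {U : Set (EuclideanSpace ℝ (Fin n))} :
    U ∈ coordFilter n j ↔ ∀ i : Fin n, i.val < j → U ∈ comap (fun x => x i) (cobounded ℝ) := by
  simp only [coordFilter, mem_iSup]

/-- The filter `coordFilter n j` together with one end of the `j`-th coordinate axis. -/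
noncomputable def halfFilter {n : ℕ} (j : Fin n) (ε : ℝ) : Filter (EuclideanSpace ℝ (Fin n)) :=
  coordFilter n j ⊔ comap (fun x => ε * x j) atBot

lemma coordFilter_succ {n : ℕ} (j : Fin n) :
    coordFilter n (j + 1) = halfFilter j 1 ⊔ halfFilter j (-1) := by
  have hco : cobounded ℝ = atBot ⊔ atTop := by
    rw [Metric.cobounded_eq_cocompact, cocompact_eq_atBot_atTop]
  have hneg : comap (fun x : EuclideanSpace ℝ (Fin n) => -1 * x j) atBot
      = comap (fun x => x j) atTop := by
    rw [← comap_neg_atBot, comap_comap]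
    simp [Function.comp_def]
  ext U
  simp only [halfFilter, hneg, one_mul, mem_sup, mem_coordFilter]
  have hj : U ∈ comap (fun x : EuclideanSpace ℝ (Fin n) => x j) (cobounded ℝ) ↔
      U ∈ comap (fun x => x j) atBot ∧ U ∈ comap (fun x => x j) atTop := by
    rw [hco, comap_sup, mem_sup]
  constructor
  · intro h
    have h1 := fun i (hi : i.val < j.val) => h i (Nat.lt_succ_of_lt hi)
    have h2 := hj.1 (h j (Nat.lt_succ_self _))
    exact ⟨⟨h1, h2.1⟩, h1, h2.2⟩
  · rintro ⟨⟨h1, h2⟩, -, h3⟩ i hi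
    rcases Nat.lt_succ_iff_lt_or_eq.1 hi with hlt | heq
    · exact h1 i hlt
    · obtain rfl : i = j := Fin.ext heq
      exact hj.2 ⟨h2, h3⟩

variable {R : Type v} [Ring R]

/-- Pushing along the `j`-th axis to the end where the cochain vanishes leaves the other coordinates
fixed, hence respects the filter. -/
lemma isAcyclic_supported_halfFilter {n : ℕ} (j : Fin n) {ε : ℝ} (hε : ε * ε = 1) :
    (supported R (halfFilter j ε)).IsAcyclic := by
  refine isAcyclic_supported fun U hU => ?_
  obtain ⟨h1, h2⟩ := mem_sup.1 hU
  obtain ⟨V, hV, hVU⟩ := mem_comap.1 h2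
  obtain ⟨c, hc⟩ := mem_atBot_sets.1 hV
  -- Linear interpolation of `ε * x j` between `min (ε * x j) c` at time 0 and itself at time 1;
  -- points already below `c` do not move.
  let H : EuclideanSpace ℝ (Fin n) × ℝ → EuclideanSpace ℝ (Fin n) := fun y =>
    y.1 + ((1 - y.2) * (min (ε * y.1 j) c - ε * y.1 j) * ε) • EuclideanSpace.single j 1
  have hne : ∀ y i, i ≠ j → H y i = y.1 i := by
    intro y i hi
    simp [H, hi]
  have hj : ∀ y, ε * H y j
      = ε * y.1 j + (1 - y.2) * (min (ε * y.1 j) c - ε * y.1 j) := by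
    intro y
    have : H y j = y.1 j + (1 - y.2) * (min (ε * y.1 j) c - ε * y.1 j) * ε := by simp [H]
    rw [this]
    linear_combination ((1 - y.2) * (min (ε * y.1 j) c - ε * y.1 j)) * hε
  have hU' : ∀ x : EuclideanSpace ℝ (Fin n), ε * x j ≤ c → x ∈ U := fun x hx => hVU (hc _ hx)
  refine ⟨H, by fun_prop, fun x => by simp [H], fun x => hU' _ ?_, mem_sup.2 ⟨?_, ?_⟩⟩
  · rw [hj]
    simp
  · rw [mem_coordFilter] at h1 ⊢
    intro i hi
    obtain ⟨W, hW, hWU⟩ := mem_comap.1 (h1 i hi)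
    refine mem_comap.2 ⟨W, hW, fun x hx s _ => hWU ?_⟩
    have hij : i ≠ j := fun h => by simp [h] at hi
    rw [Set.mem_preimage, hne _ _ hij]
    exact hx
  · refine mem_comap.2 ⟨Set.Iic c, Iic_mem_atBot c, fun x hx s hs => hU' _ ?_⟩
    have hx' : ε * x j ≤ c := hx
    rw [hj]
    simp [hx']

variable (R) in
/-- Restriction of a cochain to the simplices whose first vertex lies in `W`. -/
noncomputable def restrictFirst {X : Type u} (W : Set X) (n : ℕ) :
    Cochain R X n →ₗ[R] Cochain R X n where
  toFun φ := Set.indicator {v | v 0 ∈ W} φ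
  map_add' φ ψ := Set.indicator_add _ φ ψ
  map_smul' r φ := Set.indicator_const_smul _ r φ

lemma zeroLocus_restrictFirst {X : Type u} [TopologicalSpace X] (W : Set X) {n : ℕ}
    (φ : Cochain R X n) : zeroLocus φ ⊆ zeroLocus (restrictFirst R W n φ) := by
  refine zeroLocus_mono ?_
  change Function.support (Set.indicator _ φ) ⊆ _
  rw [Set.support_indicator]
  exact Set.inter_subset_right

lemma subset_zeroLocus_restrictFirst {X : Type u} [TopologicalSpace X] {U W : Set X}
    (hU : IsOpen U) (hUW : Disjoint U W) {n : ℕ} (φ : Cochain R X n) :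
    U ⊆ zeroLocus (restrictFirst R W n φ) := by
  refine fun _ hx => mem_zeroLocus_iff.2 ⟨U, hU, hx, fun v hv => ?_⟩
  have hv0 : v ∉ {v : Fin (n + 1) → X | v 0 ∈ W} := Set.disjoint_left.1 hUW (hv 0)
  exact Set.indicator_of_notMem hv0 φ

lemma sub_restrictFirst {X : Type u} (W : Set X) {n : ℕ} (φ : Cochain R X n) :
    φ - restrictFirst R W n φ = restrictFirst R Wᶜ n φ :=
  (Set.indicator_compl _ φ).symm

/-- Mayer-Vietoris for the two ends of the `j`-th axis. Cutting a cochain by the sign of the `j`-th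
coordinate of its first vertex makes each piece vanish near one end. -/
lemma nonempty_cohomology_coordFilter_succ {n : ℕ} (j : Fin n) (k : ℕ) :
    Nonempty ((supported R (coordFilter n j)).cohomology k ≃ₗ[R]
      (supported R (coordFilter n (j + 1))).cohomology (k + 1)) := by
  have hsub : ∀ ε, supported R (halfFilter j ε) ≤ supported R (coordFilter n j) :=
    fun ε m φ hφ => (mem_sup.1 hφ).1
  refine nonempty_cohomology_equiv_succ (A := supported R (halfFilter j 1))
    (B := supported R (halfFilter j (-1))) ?_ (hsub 1) (hsub (-1))
    (restrictFirst R {x | 0 ≤ x j}) ?_ ?_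
    (isAcyclic_supported_halfFilter j (by norm_num))
    (isAcyclic_supported_halfFilter j (by norm_num)) k
  · intro m
    ext φ
    rw [Submodule.mem_inf, mem_supported, mem_supported, mem_supported, coordFilter_succ, mem_sup]
  · intro m φ hφ
    refine mem_sup.2 ⟨mem_of_superset hφ (zeroLocus_restrictFirst _ φ), mem_of_superset ?_
      (subset_zeroLocus_restrictFirst (U := {x | x j < 0}) ?_ ?_ φ)⟩
    · refine mem_comap.2 ⟨Set.Iio 0, Iio_mem_atBot 0, fun x hx => ?_⟩
      simpa using hx
    · exact isOpen_lt (by fun_prop) continuous_const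
    · exact Set.disjoint_left.2 fun x (hx : x j < 0) => not_le.2 hx
  · intro m φ hφ
    rw [sub_restrictFirst]
    refine mem_sup.2 ⟨mem_of_superset hφ (zeroLocus_restrictFirst _ φ), mem_of_superset ?_
      (subset_zeroLocus_restrictFirst (U := {x | 0 < x j}) ?_ ?_ φ)⟩
    · refine mem_comap.2 ⟨Set.Iio 0, Iio_mem_atBot 0, fun x hx => ?_⟩
      simpa using hx
    · exact isOpen_lt continuous_const (by fun_prop)
    · exact Set.disjoint_left.2 fun x (hx : 0 < x j) hx' => hx' hx.le

lemma nonempty_cohomology_zero_supported_bot {X : Type u} [TopologicalSpace X] [Nonempty X] :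
    Nonempty ((supported R (⊥ : Filter X)).cohomology 0 ≃ₗ[R] R) := by
  obtain ⟨b⟩ := ‹Nonempty X›
  let f : (supported R (⊥ : Filter X)).cocycles 0 →ₗ[R] R :=
    LinearMap.proj (fun _ => b) ∘ₗ Submodule.subtype _
  have hf : Function.Bijective f := by
    constructor
    · intro φ ψ h
      refine Subtype.ext (funext fun v => ?_)
      rw [eq_of_d_eq_zero φ.2.2 v (fun _ => b), eq_of_d_eq_zero ψ.2.2 v (fun _ => b)]
      exact h
    · intro r
      refine ⟨⟨fun _ => r, mem_supported.2 mem_bot, ?_⟩, rfl⟩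
      refine LinearMap.mem_ker.2 (funext fun v => ?_)
      simp [d_apply, Fin.sum_univ_two]
  refine ⟨(Submodule.quotEquivOfEqBot _ ?_).trans (LinearEquiv.ofBijective f hf)⟩
  exact (Submodule.eq_bot_iff _).2 fun φ hφ => Subtype.ext hφ

lemma subsingleton_cohomology_succ_supported_bot {X : Type u} [TopologicalSpace X] [Nonempty X]
    (k : ℕ) : Subsingleton ((supported R (⊥ : Filter X)).cohomology (k + 1)) := by
  obtain ⟨b⟩ := ‹Nonempty X›
  refine Submodule.Quotient.subsingleton_iff.2 (eq_top_iff.2 ?_)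
  rintro ⟨φ, hφ, hd⟩ -
  refine ⟨cone b k φ, mem_supported.2 mem_bot, ?_⟩
  have h := cone_d_succ b φ
  rw [LinearMap.mem_ker.1 hd, map_zero] at h
  exact (sub_eq_zero.1 h.symm).symm

variable (R) in
theorem cohomology_supported_coordFilter (n j : ℕ) (hj : j ≤ n) (k : ℕ) :
    (k = j → Nonempty ((supported R (coordFilter n j)).cohomology k ≃ₗ[R] R)) ∧
      (k ≠ j → Subsingleton ((supported R (coordFilter n j)).cohomology k)) := by
  induction j generalizing k with
  | zero =>
    have h0 : coordFilter n 0 = ⊥ := by simp [coordFilter]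
    rw [h0]
    cases k with
    | zero => exact ⟨fun _ => nonempty_cohomology_zero_supported_bot, fun h => absurd rfl h⟩
    | succ k =>
      exact ⟨fun h => absurd h k.succ_ne_zero,
        fun _ => subsingleton_cohomology_succ_supported_bot k⟩
  | succ j ih =>
    cases k with
    | zero =>
      refine ⟨fun h => absurd h.symm j.succ_ne_zero, fun _ => ?_⟩
      refine subsingleton_cohomology_zero (A := supported R (halfFilter ⟨j, hj⟩ 1)) ?_
        (isAcyclic_supported_halfFilter _ (by norm_num))
      intro m φ hφ
      rw [mem_supported, coordFilter_succ ⟨j, hj⟩] at hφ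
      exact (mem_sup.1 hφ).1
    | succ k =>
      obtain ⟨e⟩ := nonempty_cohomology_coordFilter_succ (R := R) (⟨j, hj⟩ : Fin n) k
      obtain ⟨h1, h2⟩ := ih (Nat.le_of_succ_le hj) k
      refine ⟨fun h => ?_, fun h => ?_⟩
      · obtain ⟨e'⟩ := h1 (Nat.succ_injective h)
        exact ⟨e.symm.trans e'⟩
      · have := h2 fun h' => h (congrArg _ h')
        exact e.symm.toEquiv.subsingleton

lemma isBounded_diagSupport_iff {X : Type u} [MetricSpace X] {n : ℕ} {φ : Cochain R X n} :
    IsBounded (diagSupport φ) ↔ IsBounded (zeroLocus φ)ᶜ := by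
  have himage : ∀ i, Function.eval i '' diagSupport φ = (zeroLocus φ)ᶜ := by
    intro i
    ext x
    constructor
    · rintro ⟨_, ⟨⟨x, rfl⟩, h⟩, rfl⟩ h'
      exact h' h
    · exact fun h => ⟨fun _ => x, const_mem_diagSupport.2 (not_not.1 h), rfl⟩
  rw [← forall_isBounded_image_eval_iff]
  simp only [himage, forall_const]

/-- The Euclidean and sup metrics are bi-Lipschitz equivalent, and boundedness in the latter is
tested coordinatewise. -/
lemma isBounded_compl_iff_mem_coordFilter {n : ℕ} {U : Set (EuclideanSpace ℝ (Fin n))} :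
    IsBounded Uᶜ ↔ U ∈ coordFilter n n := by
  have h1 : IsBounded Uᶜ ↔ IsBounded (WithLp.ofLp '' Uᶜ) := by
    constructor
    · exact fun h => (PiLp.lipschitzWith_ofLp 2 (fun _ : Fin n => ℝ)).isBounded_image h
    · intro h
      refine ((PiLp.antilipschitzWith_ofLp 2 (fun _ : Fin n => ℝ)).isBounded_preimage h).subset ?_
      exact Set.subset_preimage_image _ _
  rw [h1, ← forall_isBounded_image_eval_iff, mem_coordFilter]
  refine forall_congr' fun i => ?_
  rw [mem_comap_iff_compl, Set.image_image, forall_prop_of_true i.2]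
  rfl

variable (R) in
lemma boundedlySupported_euclidean (n : ℕ) :
    boundedlySupported R (EuclideanSpace ℝ (Fin n)) = supported R (coordFilter n n) :=
  Subcomplex.ext fun _ => Submodule.ext fun _ =>
    isBounded_diagSupport_iff.trans isBounded_compl_iff_mem_coordFilter

variable (R) in
theorem Hb_euclidean (n k : ℕ) :
    (k = n → Nonempty (Hb R (EuclideanSpace ℝ (Fin n)) k ≃ₗ[R] R)) ∧
      (k ≠ n → Subsingleton (Hb R (EuclideanSpace ℝ (Fin n)) k)) := by
  obtain ⟨e⟩ := (boundedlySupported R (EuclideanSpace ℝ (Fin n))).nonempty_homology_equiv k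
  obtain ⟨h1, h2⟩ := cohomology_supported_coordFilter R n n le_rfl k
  rw [← boundedlySupported_euclidean] at h1 h2
  refine ⟨fun h => (h1 h).map e.trans, fun h => ?_⟩
  have := h2 h
  exact e.toEquiv.subsingleton

end Euclidean

end CoarseCohomology

theorem mainTheorem8 :
    (∀ (R : Type v) [Ring R] (X : Type u) [MetricSpace X] [ProperSpace X]
        [ContractibleSpace X],
      (∀ k : ℕ, ∃ e : CoarseCohomology.Hb R X k ≅ CoarseCohomology.Hc R X k,
        CoarseCohomology.compactToHb R X k ≫ e.hom = CoarseCohomology.compactToHc R X k) ∧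
      (CoarseCohomology.UniformlyContractible X →
        CoarseCohomology.UniformlyContractibleAtInfinity X ∧
        ∀ k : ℕ, IsIso (CoarseCohomology.coarseToHb R X k) →
          Nonempty (CoarseCohomology.HX R X k ≅ CoarseCohomology.Hc R X k))) ∧
    (∀ n k : ℕ,
      (k = n →
        Nonempty (CoarseCohomology.Hb ℤ (EuclideanSpace ℝ (Fin n)) k ≃ₗ[ℤ] ℤ) ∧
        Nonempty (CoarseCohomology.Hc ℤ (EuclideanSpace ℝ (Fin n)) k ≃ₗ[ℤ] ℤ)) ∧
      (k ≠ n →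
        Subsingleton (CoarseCohomology.Hb ℤ (EuclideanSpace ℝ (Fin n)) k) ∧
        Subsingleton (CoarseCohomology.Hc ℤ (EuclideanSpace ℝ (Fin n)) k))) := by
  refine ⟨fun R _ X _ _ _ => ⟨CoarseCohomology.exists_Hb_iso_Hc R X, fun h =>
    ⟨h.atInfinity, fun k hk => ?_⟩⟩, fun n k => ?_⟩
  · obtain ⟨e, -⟩ := CoarseCohomology.exists_Hb_iso_Hc R X k
    exact ⟨asIso (CoarseCohomology.coarseToHb R X k) ≪≫ e⟩
  · obtain ⟨e, -⟩ := CoarseCohomology.exists_Hb_iso_Hc ℤ (EuclideanSpace ℝ (Fin n)) k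
    obtain ⟨h1, h2⟩ := CoarseCohomology.Hb_euclidean ℤ n k
    refine ⟨fun h => ⟨h1 h, (h1 h).map e.toLinearEquiv.symm.trans⟩, fun h => ⟨h2 h, ?_⟩⟩
    have := h2 h
    exact e.toLinearEquiv.symm.toEquiv.subsingleton
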